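/- Let $\Omega_{\rm p}\subset\mathbb{R}^2$ be a regular bounded polytope, that is, $\Omega_{\rm p}=\Omega_{\rm ext}\setminus\bigcup_{i=1}^N\overline{\Omega}_{{\rm int},i}$ ($N\ge 0$), where $\Omega_{\rm ext},\Omega_{{\rm int},1},\dots,\Omega_{{\rm int},N}$ are bounded open regions, each enclosed by a simple closed polygonal chain, and the closures $\overline{\Omega}_{{\rm int},i}$ are pairwise disjoint and contained in $\Omega_{\rm ext}$. Let $\mathfrak{U}_0=\{\varphi\in C^1(\overline{\Omega}_{\rm p};\mathbb{R}^2):\varphi\cdot\mathbf{n}|_{\partial\Omega_{\rm p}}=0\}$, where $\mathbf{n}$ is the outward unit normal (defined away from the corners). Let $\epsilon>0$, $C_{\rm exp}>0$, and for $\Phi\in C^1(\overline{\Omega}_{\rm p};\mathbb{R}^2)\cap W^{2,\infty}(\Omega_{\rm p};\mathbb{R}^2)$ with Jacobian determinant $J(\Phi)=\det\nabla\Phi$ and (weak) Hessian $H(\Phi)$, put $$\mathfrak{f}_{\rm pen}^{\rm th}(\Phi)=\frac{1}{|\Omega_{\rm p}|}\int_{\Omega_{\rm p}}\exp\Big(\frac{\epsilon-J(\Phi)}{C_{\rm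 exp}}\Big)\,dx+\|H(\Phi)\|_{L^\infty(\Omega_{\rm p})}^2,$$ where the norm of $H(\Phi)$ is the essential supremum of its pointwise Frobenius norm. Let $\varphi_1,\dots,\varphi_M$ be linearly independent elements of $\mathfrak{U}_0\cap W^{2,\infty}(\Omega_{\rm p};\mathbb{R}^2)$, and for $\mathbf{a}\in\mathbb{R}^M$ put $\texttt{N}_{\rm p}(\mathbf{a})=\texttt{id}+\sum_{i=1}^M a_i\varphi_i$ and $f(\mathbf{a})=\mathfrak{f}_{\rm pen}^{\rm th}(\texttt{N}_{\rm p}(\mathbf{a}))\ge 0$. Then $\texttt{N}_{\rm p}(\mathbf{a})\in{\rm Lip}(\Omega_{\rm p};\mathbb{R}^2)$ for every $\mathbf{a}\in\mathbb{R}^M$, and: 1. there is $C>0$ such that $f(0)<C$ and, for every $\mathbf{a}\in\mathbb{R}^M$ with $f(\mathbf{a})\le C$, the map $\texttt{N}_{\rm p}(\mathbf{a})$ is a Lipschitz bijection of $\Omega_{\rm p}$ onto itself; 2. $\texttt{N}_{\rm p}(0)=\texttt{id}$; 3. $\texttt{N}_{\rm p}:\mathbb{R}^M\to{\rm Lip}(\Omega_{\rm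 p};\mathbb{R}^2)$ is Lipschitz continuous, where ${\rm Lip}(\Omega_{\rm p};\mathbb{R}^2)$ carries the norm given by the maximum of the sup norm and the best Lipschitz constant, and $f:\mathbb{R}^M\to\mathbb{R}_+$ is Lipschitz continuous on every bounded subset of $\mathbb{R}^M$. -/

import Mathlib

open Set MeasureTheory
open scoped NNReal ENNReal ContDiff

noncomputable section

namespace Registration

/-- The Euclidean plane. -/
abbrev Plane : Type := EuclideanSpace ℝ (Fin 2)

/-! ### Regular polytopes -/

/-- A closed polygonal chain is simple if its vertices are distinct and two different edges meet
at most at a common endpoint. -/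
def IsSimpleChain {n : ℕ} (P : Polygon Plane n) : Prop :=
  3 ≤ n ∧ Function.Injective P.vertices ∧
    ∀ i j : Fin n, i ≠ j →
      P.edgeSet ℝ i ∩ P.edgeSet ℝ j ⊆
        ({P i, P (finRotate n i)} : Set Plane) ∩ {P j, P (finRotate n j)}

/-- A (bounded, open) polytope isomorphic to the unit ball, i.e. the open region enclosed by a
simple closed polygonal chain: a bounded domain, lying on one side of its boundary, whose boundary
is such a chain. -/
def IsPolytopalDisk (D : Set Plane) : Prop :=
  IsOpen D ∧ IsConnected D ∧ Bornology.IsBounded D ∧ interior (closure D) = D ∧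
    ∃ (n : ℕ) (P : Polygon Plane n), IsSimpleChain P ∧ frontier D = P.boundary ℝ

/-- A regular bounded polytope: an open polytopal disk from which finitely many (possibly zero)
closed polytopal disks have been removed, the latter being pairwise disjoint and contained in the
open outer disk. -/
def IsRegularPolytope (Ω : Set Plane) : Prop :=
  ∃ (N : ℕ) (Ωext : Set Plane) (Ωint : Fin N → Set Plane),
    IsPolytopalDisk Ωext ∧ (∀ i, IsPolytopalDisk (Ωint i)) ∧
    (∀ i, closure (Ωint i) ⊆ Ωext) ∧
    (∀ i j, i ≠ j → Disjoint (closure (Ωint i)) (closure (Ωint j))) ∧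
    Ω = Ωext \ ⋃ i, closure (Ωint i)

/-- `n` is the outward unit normal to `Ω` at `x`: close to `x` the set `Ω` is the open half plane
through `x` for which `n` points outwards. At a corner no such vector exists. -/
def IsOutwardNormal (Ω : Set Plane) (x n : Plane) : Prop :=
  ‖n‖ = 1 ∧ ∃ r > 0, ∀ y ∈ Metric.ball x r, (y ∈ Ω ↔ inner ℝ (y - x) n < 0)

/-! ### Function spaces -/

/-- `φ ∈ C¹(closure Ω; ℝ²)`: `φ` is of class `C¹` in the open set `Ω`, and `φ` and its derivative
are continuous up to the boundary. -/
def IsC1UpToBoundary (Ω : Set Plane) (φ : Plane → Plane) : Prop :=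
  ContDiffOn ℝ 1 φ Ω ∧ ContinuousOn φ (closure Ω) ∧
    ∃ G : Plane → Plane →L[ℝ] Plane, ContinuousOn G (closure Ω) ∧ ∀ x ∈ Ω, fderiv ℝ φ x = G x

/-- The space `𝔘₀(Ω)` of fields in `C¹(closure Ω; ℝ²)` whose normal component vanishes on the
boundary. -/
def MemU0 (Ω : Set Plane) (φ : Plane → Plane) : Prop :=
  IsC1UpToBoundary Ω φ ∧
    ∀ x ∈ frontier Ω, ∀ n : Plane, IsOutwardNormal Ω x n → inner ℝ (φ x) n = 0

/-- The classical partial derivative of a scalar function in the `i`-th coordinate direction. -/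
def partialDeriv (i : Fin 2) (η : Plane → ℝ) : Plane → ℝ :=
  fun x => fderiv ℝ η x (EuclideanSpace.single i 1)

/-- The iterated classical partial derivative along a list of coordinate directions. -/
def iterPartial (α : List (Fin 2)) (η : Plane → ℝ) : Plane → ℝ :=
  α.foldr partialDeriv η

/-- `v` is the weak (distributional) partial derivative of `u` in `Ω` along the list of coordinate
directions `α`. -/
def IsWeakPartial (Ω : Set Plane) (α : List (Fin 2)) (u v : Plane → ℝ) : Prop :=
  LocallyIntegrableOn u Ω ∧ LocallyIntegrableOn v Ω ∧
    ∀ η : Plane → ℝ, ContDiff ℝ ∞ η → HasCompactSupport η → tsupport η ⊆ Ω →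
      ∫ x in Ω, u x * iterPartial α η x = (-1) ^ α.length * ∫ x in Ω, v x * η x

/-- The field `w` belongs to the Sobolev space `W^{2,∞}(Ω; ℝ²)`: all weak partial derivatives of
order at most two of its components exist and belong to `L^∞(Ω)`. -/
def MemW2Infty (Ω : Set Plane) (w : Plane → Plane) : Prop :=
  ∀ (k : Fin 2) (α : List (Fin 2)), α.length ≤ 2 →
    ∃ v : Plane → ℝ, MemLp v ∞ (volume.restrict Ω) ∧ IsWeakPartial Ω α (fun x => w x k) v

open Classical in
/-- A representative of the weak partial derivative of `u` (unique almost everywhere in an open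
set `Ω`), or zero if there is none. -/
def weakPartial (Ω : Set Plane) (α : List (Fin 2)) (u : Plane → ℝ) : Plane → ℝ :=
  if h : ∃ v, IsWeakPartial Ω α u v then h.choose else 0

/-- The pointwise Frobenius norm of the (weak) Hessian of the field `w`. -/
def hessianNorm (Ω : Set Plane) (w : Plane → Plane) (x : Plane) : ℝ :=
  √(∑ k : Fin 2, ∑ i : Fin 2, ∑ j : Fin 2, (weakPartial Ω [i, j] (fun y => w y k) x) ^ 2)

/-! ### The penalty -/

/-- The Jacobian determinant of `Φ`. -/
def jacobian (Φ : Plane → Plane) (x : Plane) : ℝ := (fderiv ℝ Φ x).det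

/-- The exponential Jacobian barrier
`|Ω|⁻¹ ∫_Ω exp ((ε - J(Φ)) / Cexp)`. -/
def fJac (Ω : Set Plane) (ε Cexp : ℝ) (Φ : Plane → Plane) : ℝ :=
  (volume.real Ω)⁻¹ * ∫ x in Ω, Real.exp ((ε - jacobian Φ x) / Cexp)

/-- The penalty `fJac(Φ) + ‖H(Φ)‖²_{L^∞(Ω)}`. -/
def fPenTh (Ω : Set Plane) (ε Cexp : ℝ) (Φ : Plane → Plane) : ℝ :=
  fJac Ω ε Cexp Φ + (eLpNorm (hessianNorm Ω Φ) ∞ (volume.restrict Ω)).toReal ^ 2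

/-! ### The affine operator and the requirements on mapping spaces -/

/-- The affine operator `N_p(a) = id + ∑ aᵢ φᵢ`. -/
def affineMapOp {M : ℕ} (φ : Fin M → Plane → Plane) (a : EuclideanSpace ℝ (Fin M)) :
    Plane → Plane :=
  fun x => x + ∑ i, a i • φ i x

/-- `Φ` is a Lipschitz bijection from `Ω` onto itself. -/
def IsLipschitzBijection (Ω : Set Plane) (Φ : Plane → Plane) : Prop :=
  (∃ K : ℝ≥0, LipschitzOnWith K Φ Ω) ∧ BijOn Φ Ω Ω

/-- The norm of `u` in `Lip(Ω; ℝ²)` (the maximum of the sup norm and of the best Lipschitz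
constant) is at most `K`. -/
def LipNormLE (Ω : Set Plane) (u : Plane → Plane) (K : ℝ) : Prop :=
  (∀ x ∈ Ω, ‖u x‖ ≤ K) ∧ ∀ x ∈ Ω, ∀ y ∈ Ω, ‖u x - u y‖ ≤ K * ‖x - y‖

/-- The requirements on an operator `N : ℝ^M → Lip(Ω; ℝ²)` and a penalty `f : ℝ^M → ℝ₊`. -/
structure SatisfiesRequirements (Ω : Set Plane) {M : ℕ}
    (N : EuclideanSpace ℝ (Fin M) → Plane → Plane) (f : EuclideanSpace ℝ (Fin M) → ℝ) :
    Prop where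
  /-- `N` takes values in `Lip(Ω; ℝ²)`. -/
  lipschitz_values : ∀ a, ∃ K : ℝ, LipNormLE Ω (N a) K
  /-- `f` takes nonnegative values. -/
  nonneg : ∀ a, 0 ≤ f a
  /-- Some sublevel set of `f` yields bijections only, and `0` lies strictly inside it. -/
  sublevel : ∃ C > 0, (∀ a, f a ≤ C → IsLipschitzBijection Ω (N a)) ∧ f 0 < C
  /-- `N(0) = id`. -/
  map_zero : N 0 = id
  /-- `N : ℝ^M → Lip(Ω; ℝ²)` is Lipschitz continuous. -/
  lipschitz_map : ∃ L : ℝ, ∀ a b, LipNormLE Ω (fun x => N a x - N b x) (L * ‖a - b‖)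
  /-- `f` is Lipschitz continuous on bounded subsets of `ℝ^M`. -/
  lipschitz_pen : ∀ R : ℝ, ∃ L : ℝ≥0, LipschitzOnWith L f (Metric.closedBall 0 R)

end Registration

end

noncomputable section

namespace Registration

open Filter Topology

/-! ### Linear algebra in the plane -/

/-! The sublevel condition rests on three facts. The Hessian term controls `‖a‖` from below, the
barrier term is minimal at `a = 0`, and small coefficients give bijections. The level can therefore
be chosen slightly above the value at `0`.

Small coefficients. Near a boundary point a regular polytope is a half plane or a sector
(`isPolygonalDomain`). A tangential field is orthogonal to two independent normals at a corner,
hence vanishes there. Along an edge it is parallel to the edge, so when its Lipschitz constant is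
below one, the perturbed identity is a monotone map of the edge fixing both ends. The boundary is
thus mapped onto itself. Injectivity, openness of the image and a connectedness argument in each
component then give a bijection of the domain (`MemU0.bijOn`). Connectedness of the domain itself is
not needed.

Barrier. For small `a`, the change of variables formula gives the Jacobian average one. This average
is a quadratic polynomial along each ray, so it is one for every `a` (`integral_detPoly`). Convexity
of the exponential, in the form of its tangent line at Jacobian one, makes the barrier at least its
value at the identity (`le_fJac_affineMapOp`).

Hessian. The identity has zero Hessian, so the Hessian of the map depends linearly on `a`. If it
vanishes, the field is affine on each component. An affine tangential field is zero: it vanishes at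
every point of the closed component farthest from some centre, because such a point must be a
corner, and sending the centre to infinity forces each coordinate to vanish
(`MemU0.eq_zero_of_affine`). With linear independence the linear map is injective, and in finite
dimension it is bounded below (`exists_hessian_bounds`).

The Lipschitz assertions use uniform bounds for the fields and their gradients. The fields are
Lipschitz up to the boundary, even at reflex corners (`IsC1UpToBoundary.exists_lipschitzOnWith`). -/

/-- The determinant of a pair of vectors of the plane. -/
def cross (u v : Plane) : ℝ := u 0 * v 1 - u 1 * v 0

/-- Rotation by a right angle. -/
def rot (u : Plane) : Plane := !₂[-(u 1), u 0]

theorem inner_eq (u v : Plane) : inner ℝ u v = u 0 * v 0 + u 1 * v 1 := by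
  simp [PiLp.inner_apply, Fin.sum_univ_two]; ring

theorem norm_sq_eq (u : Plane) : ‖u‖ ^ 2 = u 0 ^ 2 + u 1 ^ 2 := by
  rw [← real_inner_self_eq_norm_sq, inner_eq]; ring

theorem inner_rot (w u : Plane) : inner ℝ w (rot u) = cross u w := by
  rw [inner_eq]; simp [rot, cross]; ring

theorem norm_rot (u : Plane) : ‖rot u‖ = ‖u‖ := by
  have h : ‖rot u‖ ^ 2 = ‖u‖ ^ 2 := by
    rw [norm_sq_eq, norm_sq_eq]; simp [rot]; ring
  exact (sq_eq_sq₀ (norm_nonneg _) (norm_nonneg _)).1 h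

theorem plane_ext {u v : Plane} (h0 : u 0 = v 0) (h1 : u 1 = v 1) : u = v := by
  ext i; fin_cases i <;> assumption

/-- Cramer's rule. It supplies directions along one side of a sector that point to a prescribed side
of the other. -/
theorem exists_inner_eq {m₁ m₂ : Plane} (h : cross m₁ m₂ ≠ 0) (a b : ℝ) :
    ∃ w : Plane, inner ℝ w m₁ = a ∧ inner ℝ w m₂ = b := by
  refine ⟨(cross m₁ m₂)⁻¹ • !₂[a * m₂ 1 - b * m₁ 1, b * m₁ 0 - a * m₂ 0], ?_, ?_⟩ <;>
  · rw [inner_eq]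
    simp only [PiLp.smul_apply, smul_eq_mul, Matrix.cons_val_zero,
      Matrix.cons_val_one]
    field_simp
    simp only [cross]
    ring

theorem eq_of_inner_eq {m₁ m₂ : Plane} (h : cross m₁ m₂ ≠ 0) {w : Plane}
    (h1 : inner ℝ w m₁ = 0) (h2 : inner ℝ w m₂ = 0) : w = 0 := by
  rw [inner_eq] at h1 h2
  apply plane_ext
  · apply mul_left_cancel₀ h
    simp only [cross, PiLp.zero_apply]
    linear_combination m₂ 1 * h1 - m₁ 1 * h2
  · apply mul_left_cancel₀ h
    simp only [cross, PiLp.zero_apply]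
    linear_combination m₁ 0 * h2 - m₂ 0 * h1

/-- A vector orthogonal to a nonzero vector `n` is a multiple of any unit vector orthogonal
to `n`. -/
theorem eq_smul_of_inner_eq_zero {n a b : Plane} (hn : n ≠ 0) (ha : inner ℝ a n = 0)
    (hb : inner ℝ b n = 0) (hb1 : ‖b‖ = 1) : a = (inner ℝ a b : ℝ) • b := by
  have hc : cross b n ≠ 0 := by
    intro h0
    apply hn
    have h1 : b 0 ^ 2 + b 1 ^ 2 = 1 := by rw [← norm_sq_eq, hb1]; norm_num
    rw [inner_eq] at hb
    unfold cross at h0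
    apply plane_ext
    · simp only [PiLp.zero_apply]
      linear_combination b 0 * hb - b 1 * h0 - n 0 * h1
    · simp only [PiLp.zero_apply]
      linear_combination b 1 * hb + b 0 * h0 - n 1 * h1
  have : a - (inner ℝ a b : ℝ) • b = 0 := by
    apply eq_of_inner_eq hc
    · rw [inner_sub_left, inner_smul_left, real_inner_self_eq_norm_sq, hb1]; simp
    · rw [inner_sub_left, inner_smul_left, ha, hb]; simp
  exact sub_eq_zero.1 this

theorem convex_inner_lt (x m : Plane) : Convex ℝ {y : Plane | inner ℝ (y - x) m < 0} := by
  have h : IsLinearMap ℝ (fun y : Plane => inner ℝ y m) :=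
    ⟨fun a b => inner_add_left a b m, fun c a => by simp [inner_smul_left]⟩
  have h2 := convex_halfSpace_lt (𝕜 := ℝ) h (inner ℝ x m)
  have e : {y : Plane | inner ℝ (y - x) m < 0} = {y : Plane | inner ℝ y m < inner ℝ x m} := by
    ext y
    rw [mem_ofPred_eq, mem_ofPred_eq, inner_sub_left, sub_neg]
  rw [e]
  exact h2

theorem eventually_add_smul_mem (x w : Plane) {V : Set Plane} (hV : V ∈ 𝓝 x) :
    ∀ᶠ t : ℝ in 𝓝[>] 0, x + t • w ∈ V := by
  have h : ContinuousAt (fun t : ℝ => x + t • w) 0 := by fun_prop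
  have h2 : ∀ᶠ t : ℝ in 𝓝 0, x + t • w ∈ V := h.eventually_mem (by simpa using hV)
  exact h2.filter_mono nhdsWithin_le_nhds

/-! ### Local structure of polygonal domains -/

/-- Near `x` the set `D` is an open sector, convex or not, bounded by two non-collinear rays. -/
def IsCornerAt (D : Set Plane) (x : Plane) : Prop :=
  ∃ m₁ m₂ : Plane, cross m₁ m₂ ≠ 0 ∧ ∃ r > 0,
    (∀ y ∈ Metric.ball x r, (y ∈ D ↔ inner ℝ (y - x) m₁ < 0 ∧ inner ℝ (y - x) m₂ < 0)) ∨
    (∀ y ∈ Metric.ball x r, (y ∈ D ↔ inner ℝ (y - x) m₁ < 0 ∨ inner ℝ (y - x) m₂ < 0))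

/-- Near `x` the set `D` is an open half plane or an open sector. -/
def IsModelAt (D : Set Plane) (x : Plane) : Prop :=
  (∃ n, IsOutwardNormal D x n) ∨ IsCornerAt D x

theorem IsModelAt.congr {D E : Set Plane} {x : Plane} {U : Set Plane} (hU : U ∈ 𝓝 x)
    (h : ∀ y ∈ U, (y ∈ D ↔ y ∈ E)) (hD : IsModelAt D x) : IsModelAt E x := by
  obtain ⟨ρ, hρ, hball⟩ := Metric.mem_nhds_iff.1 hU
  have key : ∀ r, ∀ y ∈ Metric.ball x (min r ρ), y ∈ Metric.ball x r ∧ (y ∈ E ↔ y ∈ D) := by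
    intro r y hy
    exact ⟨Metric.ball_subset_ball (min_le_left _ _) hy,
      (h y (hball (Metric.ball_subset_ball (min_le_right _ _) hy))).symm⟩
  rcases hD with ⟨n, hn, r, hr, h1⟩ | ⟨m₁, m₂, hm, r, hr, h1⟩
  · refine Or.inl ⟨n, hn, min r ρ, lt_min hr hρ, fun y hy => ?_⟩
    rw [(key r y hy).2, h1 y (key r y hy).1]
  · refine Or.inr ⟨m₁, m₂, hm, min r ρ, lt_min hr hρ, ?_⟩
    refine h1.imp (fun h1 y hy => ?_) (fun h1 y hy => ?_) <;>
    rw [(key r y hy).2, h1 y (key r y hy).1]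

/-- An open set and its exterior are disjoint, open, and cover everything off the frontier. -/
theorem preconnected_subset_or {D S : Set Plane} (hD : IsOpen D) (hS : IsPreconnected S)
    (h : ∀ y ∈ S, y ∉ frontier D) : S ⊆ D ∨ ∀ y ∈ S, y ∉ D := by
  have h2 : S ⊆ D ∪ (closure D)ᶜ := by
    intro y hy
    by_cases hyc : y ∈ closure D
    · left
      by_contra hyD
      exact h y hy ⟨hyc, by rwa [hD.interior_eq]⟩
    · exact Or.inr hyc
  rcases hS.subset_or_subset hD isClosed_closure.isOpen_compl
    (disjoint_compl_right.mono_left subset_closure) h2 with h3 | h3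
  · exact Or.inl h3
  · exact Or.inr fun y hy hyD => h3 hy (subset_closure hyD)

/-- If the frontier of a regular open set separates a ball around a frontier point into two
connected pieces then the set agrees with one of them in the ball. -/
theorem local_dichotomy {D : Set Plane} (hD : IsOpen D) (hreg : interior (closure D) = D)
    {x : Plane} (hx : x ∈ frontier D) {r : ℝ} (hr : 0 < r) {p q : Plane → Prop}
    (hp : IsPreconnected {y | y ∈ Metric.ball x r ∧ p y})
    (hq : IsPreconnected {y | y ∈ Metric.ball x r ∧ q y})
    (hfr : ∀ y ∈ Metric.ball x r, (y ∈ frontier D ↔ ¬ p y ∧ ¬ q y)) :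
    (∀ y ∈ Metric.ball x r, (y ∈ D ↔ p y)) ∨ (∀ y ∈ Metric.ball x r, (y ∈ D ↔ q y)) := by
  have hxD : x ∉ D := by have := hx.2; rwa [hD.interior_eq] at this
  have hDf : ∀ y ∈ D, y ∉ frontier D := fun y hy hyf => by
    have := hyf.2; rw [hD.interior_eq] at this; exact this hy
  have hP := preconnected_subset_or hD hp (fun y hy hyf => ((hfr y hy.1).1 hyf).1 hy.2)
  have hQ := preconnected_subset_or hD hq (fun y hy hyf => ((hfr y hy.1).1 hyf).2 hy.2)
  have hcov : ∀ y ∈ Metric.ball x r, y ∈ D → p y ∨ q y := fun y hy hyD => by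
    by_contra hcon
    rw [not_or] at hcon
    exact hDf y hyD ((hfr y hy).2 hcon)
  rcases hP with hP | hP <;> rcases hQ with hQ | hQ
  -- If both pieces lay in `D`, a whole ball would lie in `closure D`, and regularity would put `x`
  -- in `D`.
  · exfalso
    apply hxD
    rw [← hreg, mem_interior_iff_mem_nhds]
    filter_upwards [Metric.ball_mem_nhds x hr] with y hy
    by_cases h1 : p y
    · exact subset_closure (hP ⟨hy, h1⟩)
    by_cases h2 : q y
    · exact subset_closure (hQ ⟨hy, h2⟩)
    exact ((hfr y hy).2 ⟨h1, h2⟩).1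
  · left
    intro y hy
    refine ⟨fun hyD => (hcov y hy hyD).resolve_right fun h => hQ y ⟨hy, h⟩ hyD,
      fun h => hP ⟨hy, h⟩⟩
  · right
    intro y hy
    refine ⟨fun hyD => (hcov y hy hyD).resolve_left fun h => hP y ⟨hy, h⟩ hyD,
      fun h => hQ ⟨hy, h⟩⟩
  -- If neither piece met `D`, then `x` would not be in the closure of `D`.
  · exfalso
    obtain ⟨y, hyb, hyD⟩ := mem_closure_iff.1 hx.1 _ Metric.isOpen_ball (Metric.mem_ball_self hr)
    rcases hcov y hyb hyD with h | h
    · exact hP y ⟨hyb, h⟩ hyD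
    · exact hQ y ⟨hyb, h⟩ hyD

/-- A reflex sector is the union of two convex half discs, which share a point in a direction
negative on both normals. -/
theorem isPreconnected_ball_inter_or {m₁ m₂ : Plane} (hm : cross m₁ m₂ ≠ 0) (x : Plane) {r : ℝ}
    (hr : 0 < r) : IsPreconnected {y | y ∈ Metric.ball x r ∧
      (inner ℝ (y - x) m₁ < 0 ∨ inner ℝ (y - x) m₂ < 0)} := by
  obtain ⟨w, hw1, hw2⟩ := exists_inner_eq hm (-1) (-1)
  obtain ⟨t, ht, ht0⟩ := ((eventually_add_smul_mem x w (Metric.ball_mem_nhds x hr)).and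
    self_mem_nhdsWithin).exists
  have ht0 : 0 < t := ht0
  have h1 := ((convex_ball x r).inter (convex_inner_lt x m₁)).isPreconnected
  have h2 := ((convex_ball x r).inter (convex_inner_lt x m₂)).isPreconnected
  have h3 := h1.union (x + t • w)
    (mem_inter ht (by simp [inner_smul_left, hw1, ht0]))
    (mem_inter ht (by simp [inner_smul_left, hw2, ht0])) h2
  rw [← inter_union_distrib_left] at h3
  exact h3

/-- A regular open set whose frontier near `x` consists of two rays emanating from `x` is, near
`x`, a half plane or a sector. -/
theorem isModelAt_of_rays {D : Set Plane} (hD : IsOpen D) (hreg : interior (closure D) = D)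
    {x : Plane} (hx : x ∈ frontier D) {u v : Plane} (hu : u ≠ 0)
    (huv : cross u v ≠ 0 ∨ ∃ c : ℝ, 0 < c ∧ v = -(c • u)) {r : ℝ} (hr : 0 < r)
    (hfr : ∀ y ∈ Metric.ball x r,
      (y ∈ frontier D ↔ ∃ t : ℝ, 0 ≤ t ∧ (y - x = t • u ∨ y - x = t • v))) :
    IsModelAt D x := by
  rcases huv with huv | ⟨c, hc, rfl⟩
  -- `m₁, m₂` is the basis dual to `u, v`. The two rays separate the convex sector with both
  -- coordinates positive from the reflex sector with some coordinate negative.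
  · set m₁ : Plane := (-(cross u v)⁻¹) • rot v with hm₁
    set m₂ : Plane := (cross u v)⁻¹ • rot u with hm₂
    have e1 : ∀ w, inner ℝ w m₁ = (cross u v)⁻¹ * cross w v := fun w => by
      rw [hm₁, inner_smul_right, inner_rot]; simp only [cross]; ring
    have e2 : ∀ w, inner ℝ w m₂ = (cross u v)⁻¹ * cross u w := fun w => by
      rw [hm₂, inner_smul_right, inner_rot]
    have hm : cross m₁ m₂ ≠ 0 := by
      have : cross m₁ m₂ = (cross u v)⁻¹ := by
        have : cross m₁ m₂ = (cross u v)⁻¹ * (cross u v)⁻¹ * cross u v := by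
          rw [hm₁, hm₂]
          simp only [cross, rot, PiLp.smul_apply, smul_eq_mul,
            Matrix.cons_val_zero, Matrix.cons_val_one]
          ring
        rw [this]; field_simp
      rw [this]; exact inv_ne_zero huv
    have hm' : cross (-m₁) (-m₂) ≠ 0 := by
      have : cross (-m₁) (-m₂) = cross m₁ m₂ := by simp [cross]
      rwa [this]
    have hrep : ∀ w : Plane, w = (inner ℝ w m₁ : ℝ) • u + (inner ℝ w m₂ : ℝ) • v := by
      intro w
      rw [e1, e2]
      apply plane_ext
      · simp only [PiLp.add_apply, PiLp.smul_apply, smul_eq_mul]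
        field_simp; simp only [cross]; ring
      · simp only [PiLp.add_apply, PiLp.smul_apply, smul_eq_mul]
        field_simp; simp only [cross]; ring
    have hu1 : ∀ t : ℝ, inner ℝ (t • u) m₁ = t ∧ inner ℝ (t • u) m₂ = 0 := fun t => by
      rw [inner_smul_left, inner_smul_left, e1, e2]; constructor
      · rw [inv_mul_cancel₀ huv]; simp
      · simp [cross, mul_comm]
    have hv1 : ∀ t : ℝ, inner ℝ (t • v) m₁ = 0 ∧ inner ℝ (t • v) m₂ = t := fun t => by
      rw [inner_smul_left, inner_smul_left, e1, e2]; constructor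
      · simp [cross, mul_comm]
      · rw [inv_mul_cancel₀ huv]; simp
    have hfr' : ∀ y ∈ Metric.ball x r, (y ∈ frontier D ↔
        ¬ (inner ℝ (y - x) (-m₁) < 0 ∧ inner ℝ (y - x) (-m₂) < 0) ∧
        ¬ (inner ℝ (y - x) m₁ < 0 ∨ inner ℝ (y - x) m₂ < 0)) := by
      intro y hy
      rw [hfr y hy]
      simp only [inner_neg_right]
      constructor
      · rintro ⟨t, ht, h | h⟩
        · rw [h, (hu1 t).1, (hu1 t).2]; grind
        · rw [h, (hv1 t).1, (hv1 t).2]; grind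
      · rintro ⟨h1, h2⟩
        have h3 := hrep (y - x)
        push Not at h2
        by_cases h0 : inner ℝ (y - x) m₁ = 0
        · exact ⟨_, h2.2, Or.inr (by rw [h0] at h3; simpa using h3)⟩
        · refine ⟨_, h2.1, Or.inl ?_⟩
          have : inner ℝ (y - x) m₂ = 0 := by
            have := lt_of_le_of_ne h2.1 (Ne.symm h0)
            by_contra h5
            have := lt_of_le_of_ne h2.2 (Ne.symm h5)
            exact h1 ⟨by linarith, by linarith⟩
          rw [this] at h3; simpa using h3
    rcases local_dichotomy hD hreg hx hr
      (p := fun y => inner ℝ (y - x) (-m₁) < 0 ∧ inner ℝ (y - x) (-m₂) < 0)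
      (q := fun y => inner ℝ (y - x) m₁ < 0 ∨ inner ℝ (y - x) m₂ < 0)
      ((convex_ball x r).inter ((convex_inner_lt x _).inter (convex_inner_lt x _))).isPreconnected
      (isPreconnected_ball_inter_or hm x hr)
      hfr' with h | h
    · exact Or.inr ⟨-m₁, -m₂, hm', r, hr, Or.inl h⟩
    · exact Or.inr ⟨m₁, m₂, hm, r, hr, Or.inr h⟩
  · have hn0 : 0 < ‖u‖ := norm_pos_iff.2 hu
    set n : Plane := ‖u‖⁻¹ • rot u with hn
    have hn1 : ‖n‖ = 1 := by
      rw [hn, norm_smul, norm_rot, norm_inv, norm_norm, inv_mul_cancel₀ hn0.ne']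
    have e : ∀ w, inner ℝ w n = ‖u‖⁻¹ * cross u w := fun w => by
      rw [hn, inner_smul_right, inner_rot]
    have hfr' : ∀ y ∈ Metric.ball x r, (y ∈ frontier D ↔
        ¬ inner ℝ (y - x) (-n) < 0 ∧ ¬ inner ℝ (y - x) n < 0) := by
      intro y hy
      rw [hfr y hy]
      have hcr : (¬ inner ℝ (y - x) (-n) < 0 ∧ ¬ inner ℝ (y - x) n < 0) ↔ cross u (y - x) = 0 := by
        have : inner ℝ (y - x) n = 0 ↔ cross u (y - x) = 0 := by
          rw [e]; simp [hu]
        rw [← this, inner_neg_right]; grind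
      rw [hcr]
      constructor
      · rintro ⟨t, ht, h | h⟩
        · rw [h]; simp [cross]; ring
        · rw [h]; simp [cross]; ring
      · intro h
        have hu2 : 0 < u 0 ^ 2 + u 1 ^ 2 := by rw [← norm_sq_eq]; positivity
        have h3 : y - x = (inner ℝ (y - x) u / ‖u‖ ^ 2) • u := by
          rw [inner_eq, norm_sq_eq]
          unfold cross at h
          apply plane_ext
          · simp only [PiLp.smul_apply, smul_eq_mul]
            field_simp
            linear_combination - u 1 * h
          · simp only [PiLp.smul_apply, smul_eq_mul]
            field_simp
            linear_combination u 0 * h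
        rcases le_or_gt 0 (inner ℝ (y - x) u / ‖u‖ ^ 2) with h4 | h4
        · exact ⟨_, h4, Or.inl h3⟩
        · refine ⟨-(inner ℝ (y - x) u / ‖u‖ ^ 2) / c, by apply div_nonneg <;> linarith, Or.inr ?_⟩
          rw [smul_neg, smul_smul, ← neg_smul]
          convert h3 using 2
          field_simp
    rcases local_dichotomy hD hreg hx hr
      (p := fun y => inner ℝ (y - x) (-n) < 0) (q := fun y => inner ℝ (y - x) n < 0)
      ((convex_ball x r).inter (convex_inner_lt x _)).isPreconnected
      ((convex_ball x r).inter (convex_inner_lt x _)).isPreconnected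
      hfr' with h | h
    · exact Or.inl ⟨-n, by rwa [norm_neg], r, hr, h⟩
    · exact Or.inl ⟨n, hn1, r, hr, h⟩

/-! ### Regular polytopes are locally half planes or sectors -/

theorem finRotate_ne_self {n : ℕ} (hn : 3 ≤ n) (i : Fin n) : finRotate n i ≠ i := by
  obtain ⟨m, rfl⟩ : ∃ m, n = m + 1 := ⟨n - 1, by omega⟩
  intro h
  have := congrArg Fin.val h
  rw [coe_finRotate] at this
  split_ifs at this with hi
  · subst hi; simp at this; omega
  · omega

/-- The two neighbours of a vertex are distinct; this needs at least three vertices. -/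
theorem finRotate_finRotate_ne_self {n : ℕ} (hn : 3 ≤ n) (i : Fin n) :
    finRotate n (finRotate n i) ≠ i := by
  obtain ⟨m, rfl⟩ : ∃ m, n = m + 1 := ⟨n - 1, by omega⟩
  intro h
  have h2 := congrArg Fin.val h
  rw [coe_finRotate] at h2
  have h3 : (finRotate (m + 1) i).val = if i = Fin.last m then 0 else i.val + 1 := coe_finRotate i
  have h4 := i.2
  have hl : ∀ j : Fin (m + 1), j = Fin.last m ↔ j.val = m := fun j => by
    rw [Fin.ext_iff, Fin.val_last]
  simp only [hl] at h2 h3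
  split_ifs at h2 h3 <;> omega

theorem mem_segment_iff_of_near {x b : Plane} {y : Plane} (hy : dist y x < dist b x) :
    y ∈ segment ℝ x b ↔ ∃ t : ℝ, 0 ≤ t ∧ y - x = t • (b - x) := by
  rw [segment_eq_image']
  constructor
  · rintro ⟨t, ht, rfl⟩
    exact ⟨t, ht.1, by simp⟩
  · rintro ⟨t, ht, h⟩
    refine ⟨t, ⟨ht, ?_⟩, by simp [← h]⟩
    rw [dist_eq_norm, dist_eq_norm, h, norm_smul, Real.norm_of_nonneg ht] at hy
    by_contra hlt
    push Not at hlt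
    nlinarith [norm_nonneg (b - x)]

theorem segment_eq_union {p q x : Plane} (hx : x ∈ segment ℝ p q) :
    segment ℝ p q = segment ℝ x p ∪ segment ℝ x q := by
  apply Subset.antisymm
  · rw [segment_eq_image'] at hx
    obtain ⟨s, hs, rfl⟩ := hx
    rw [segment_eq_image', segment_eq_image', segment_eq_image']
    rintro y ⟨t, ht, rfl⟩
    rcases le_or_gt t s with hts | hts
    · left
      rcases hs.1.eq_or_lt with h0 | h0
      · have : t = 0 := le_antisymm (h0 ▸ hts) ht.1
        exact ⟨0, by simp, by simp [this, ← h0]⟩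
      · refine ⟨(s - t) / s, ⟨by apply div_nonneg <;> linarith,
          (div_le_one h0).2 (by linarith [ht.1])⟩, ?_⟩
        have h1 : p - (p + s • (q - p)) = s • (p - q) := by module
        simp only [h1, smul_smul]
        rw [div_mul_cancel₀ _ h0.ne']
        module
    · right
      have h0 : 0 < 1 - s := by linarith [ht.2]
      refine ⟨(t - s) / (1 - s), ⟨by apply div_nonneg <;> linarith,
        (div_le_one h0).2 (by linarith [ht.2])⟩, ?_⟩
      have h1 : q - (p + s • (q - p)) = (1 - s) • (q - p) := by module
      simp only [h1, smul_smul]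
      rw [div_mul_cancel₀ _ h0.ne']
      module
  · exact union_subset ((convex_segment p q).segment_subset hx (left_mem_segment ℝ p q))
      ((convex_segment p q).segment_subset hx (right_mem_segment ℝ p q))

theorem isCompact_edgeSet {n : ℕ} (P : Polygon Plane n) (i : Fin n) :
    IsCompact (P.edgeSet ℝ i) :=
  isCompact_Icc.image (AffineMap.lineMap_continuous)

/-- Near any of its points, a simple closed polygonal chain consists of two segments. -/
theorem IsSimpleChain.exists_two_segments {n : ℕ} {P : Polygon Plane n} (hP : IsSimpleChain P)
    {x : Plane} (hx : x ∈ P.boundary ℝ) :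
    ∃ a b : Plane, a ≠ x ∧ b ≠ x ∧
      (cross (a - x) (b - x) ≠ 0 ∨ ∃ c : ℝ, 0 < c ∧ b - x = -(c • (a - x))) ∧
      ∀ᶠ y in 𝓝 x, (y ∈ P.boundary ℝ ↔ y ∈ segment ℝ x a ∨ y ∈ segment ℝ x b) := by
  obtain ⟨hn, hinj, hsimple⟩ := hP
  have hinj' : ∀ {i j : Fin n}, P i = P j → i = j := fun h => hinj h
  have hseg : ∀ i, P.edgeSet ℝ i = segment ℝ (P i) (P (finRotate n i)) := fun i =>
    affineSegment_eq_segment ℝ _ _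
  have hclosed : ∀ s : Finset (Fin n), (∀ k ∈ s, x ∉ P.edgeSet ℝ k) →
      ∀ᶠ y in 𝓝 x, ∀ k ∈ s, y ∉ P.edgeSet ℝ k := by
    intro s hs
    rw [eventually_all_finset]
    exact fun k hk => (isCompact_edgeSet P k).isClosed.isOpen_compl.mem_nhds (hs k hk)
  by_cases hv : ∃ i, P i = x
  · obtain ⟨i, rfl⟩ := hv
    set j := (finRotate n).symm i with hj
    have hji : finRotate n j = i := by rw [hj, Equiv.apply_symm_apply]
    have hne : i ≠ j := fun h => finRotate_ne_self hn j (by rw [hji]; exact h)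
    have hij : finRotate n i ≠ j := fun h => finRotate_finRotate_ne_self hn i (by rw [h, hji])
    have hi1 : P (finRotate n i) ≠ P i := fun h => finRotate_ne_self hn i (hinj' h)
    have hj1 : P j ≠ P i := fun h => hne (hinj' h).symm
    have hei : P.edgeSet ℝ i = segment ℝ (P i) (P (finRotate n i)) := hseg i
    have hej : P.edgeSet ℝ j = segment ℝ (P i) (P j) := by rw [hseg j, hji, segment_symm]
    have hint : ∀ y, y ∈ segment ℝ (P i) (P (finRotate n i)) → y ∈ segment ℝ (P i) (P j) →
        y = P i := by
      intro y h1 h2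
      rw [← hei] at h1; rw [← hej] at h2
      obtain ⟨h3, h4⟩ := hsimple i j hne ⟨h1, h2⟩
      rw [hji] at h4
      rcases h3 with h3 | h3
      · exact h3
      · rcases h4 with h4 | h4
        · exact absurd (hinj' (h3.symm.trans h4)) hij
        · exact h4
    refine ⟨P (finRotate n i), P j, hi1, hj1, ?_, ?_⟩
    · set a := P (finRotate n i)
      set b := P j
      set x := P i
      by_contra hcon
      push Not at hcon
      obtain ⟨h0, hc⟩ := hcon
      have ha : 0 < (a - x) 0 ^ 2 + (a - x) 1 ^ 2 := by
        rw [← norm_sq_eq]; have := norm_pos_iff.2 (sub_ne_zero.2 hi1); positivity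
      set k : ℝ := inner ℝ (b - x) (a - x) / ((a - x) 0 ^ 2 + (a - x) 1 ^ 2) with hk
      have hb : b - x = k • (a - x) := by
        unfold cross at h0
        rw [hk, inner_eq]
        apply plane_ext
        · rw [PiLp.smul_apply (x := a - x), smul_eq_mul]
          field_simp
          linear_combination - (a - x) 1 * h0
        · rw [PiLp.smul_apply (x := a - x), smul_eq_mul]
          field_simp
          linear_combination (a - x) 0 * h0
      have hk0 : 0 < k := by
        rcases lt_trichotomy k 0 with h | h | h
        · exact absurd (by rw [hb]; simp) (hc (-k) (by linarith))
        · rw [h, zero_smul] at hb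
          exact absurd (sub_eq_zero.1 hb) hj1
        · exact h
      -- If the two edges left `x` in the same direction, the point at parameter `ε` would lie on
      -- both, although they share only `x`.
      set ε : ℝ := min 1 k with hε
      have hε0 : 0 < ε := lt_min one_pos hk0
      have h1 : x + ε • (a - x) ∈ segment ℝ x a := by
        rw [segment_eq_image']
        exact ⟨ε, ⟨hε0.le, min_le_left _ _⟩, rfl⟩
      have h2 : x + ε • (a - x) ∈ segment ℝ x b := by
        rw [segment_eq_image']
        refine ⟨ε / k, ⟨by positivity, (div_le_one hk0).2 (min_le_right _ _)⟩, ?_⟩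
        simp only [hb, smul_smul]
        rw [div_mul_cancel₀ _ hk0.ne']
      have h3 := hint _ h1 h2
      rw [add_eq_left, smul_eq_zero] at h3
      rcases h3 with h3 | h3
      · exact hε0.ne' h3
      · exact hi1 (sub_eq_zero.1 h3)
    · have hother : ∀ k ∈ ({k | k ≠ i ∧ k ≠ j} : Finset (Fin n)), P i ∉ P.edgeSet ℝ k := by
        intro k hk hxk
        simp only [Finset.mem_filter, Finset.mem_univ, true_and] at hk
        have hxi : P i ∈ P.edgeSet ℝ i := by rw [hei]; exact left_mem_segment ℝ _ _
        rcases (hsimple i k (Ne.symm hk.1) ⟨hxi, hxk⟩).2 with h | h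
        · exact hk.1 (hinj' h).symm
        · exact hk.2 (by rw [hj, hinj' h, Equiv.symm_apply_apply])
      filter_upwards [hclosed _ hother] with y hy
      rw [Polygon.boundary, mem_iUnion]
      constructor
      · rintro ⟨k, hk⟩
        by_cases hki : k = i
        · subst hki; left; rwa [hei] at hk
        by_cases hkj : k = j
        · subst hkj; right; rwa [hej] at hk
        exact absurd hk (hy k (by simp [hki, hkj]))
      · rintro (h | h)
        · exact ⟨i, by rwa [hei]⟩
        · exact ⟨j, by rwa [hej]⟩
  · push Not at hv
    rw [Polygon.boundary, mem_iUnion] at hx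
    obtain ⟨i, hi⟩ := hx
    have hi2 := hi
    rw [hseg i] at hi2
    obtain ⟨α, β, hα, hβ, hαβ, hxe⟩ := hi2
    have hα0 : 0 < α := lt_of_le_of_ne hα fun h => by
      subst h; rw [zero_add] at hαβ; subst hαβ
      exact hv (finRotate n i) (by simpa using hxe)
    have hβ0 : 0 < β := lt_of_le_of_ne hβ fun h => by
      subst h; rw [add_zero] at hαβ; subst hαβ
      exact hv i (by simpa using hxe)
    refine ⟨P i, P (finRotate n i), hv _, hv _, Or.inr ⟨α / β, by positivity, ?_⟩, ?_⟩
    · have h1 : α = 1 - β := by linarith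
      rw [← hxe, h1]
      apply smul_right_injective Plane hβ0.ne'
      simp only [smul_neg, smul_smul]
      rw [mul_div_cancel₀ _ hβ0.ne']
      module
    · have hother : ∀ k ∈ ({k | k ≠ i} : Finset (Fin n)), x ∉ P.edgeSet ℝ k := by
        intro k hk hxk
        simp only [Finset.mem_filter, Finset.mem_univ, true_and] at hk
        rcases (hsimple i k (Ne.symm hk) ⟨hi, hxk⟩).1 with h | h
        · exact hv i h.symm
        · exact hv _ h.symm
      filter_upwards [hclosed _ hother] with y hy
      have hsplit : P.edgeSet ℝ i =
          segment ℝ x (P i) ∪ segment ℝ x (P (finRotate n i)) := by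
        rw [hseg i]
        exact segment_eq_union (by rw [← hseg i]; exact hi)
      rw [← mem_union, ← hsplit, Polygon.boundary, mem_iUnion]
      constructor
      · rintro ⟨k, hk⟩
        by_cases hki : k = i
        · subst hki; exact hk
        exact absurd hk (hy k (by simp [hki]))
      · exact fun h => ⟨i, h⟩

theorem isModelAt_of_polygon {D : Set Plane} (hD : IsOpen D) (hreg : interior (closure D) = D)
    {n : ℕ} {P : Polygon Plane n} (hP : IsSimpleChain P) (hfr : frontier D = P.boundary ℝ)
    {x : Plane} (hx : x ∈ frontier D) : IsModelAt D x := by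
  obtain ⟨a, b, ha, hb, hc, he⟩ := hP.exists_two_segments (hfr ▸ hx)
  obtain ⟨r, hr, hball⟩ := Metric.eventually_nhds_iff_ball.1 he
  refine isModelAt_of_rays hD hreg hx (sub_ne_zero.2 ha) hc
    (lt_min hr (lt_min (dist_pos.2 ha) (dist_pos.2 hb))) fun y hy => ?_
  rw [Metric.mem_ball, lt_min_iff, lt_min_iff] at hy
  rw [hfr, hball y hy.1, mem_segment_iff_of_near hy.2.1, mem_segment_iff_of_near hy.2.2]
  constructor
  · rintro (⟨t, ht, h⟩ | ⟨t, ht, h⟩)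
    · exact ⟨t, ht, Or.inl h⟩
    · exact ⟨t, ht, Or.inr h⟩
  · rintro ⟨t, ht, h | h⟩
    · exact Or.inl ⟨t, ht, h⟩
    · exact Or.inr ⟨t, ht, h⟩

theorem frontier_compl_closure {D : Set Plane} (hD : IsOpen D)
    (hreg : interior (closure D) = D) : frontier (closure D)ᶜ = frontier D := by
  rw [frontier_compl, frontier, frontier, closure_closure, hreg, hD.interior_eq]

theorem IsPolytopalDisk.isModelAt {D : Set Plane} (h : IsPolytopalDisk D) {x : Plane}
    (hx : x ∈ frontier D) : IsModelAt D x := by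
  obtain ⟨hD, -, -, hreg, n, P, hP, hfr⟩ := h
  exact isModelAt_of_polygon hD hreg hP hfr hx

/-- The exterior is again a regular open set with the same frontier, so the local analysis also
applies on the outer side of a hole. -/
theorem IsPolytopalDisk.isModelAt_compl {D : Set Plane} (h : IsPolytopalDisk D) {x : Plane}
    (hx : x ∈ frontier D) : IsModelAt (closure D)ᶜ x := by
  obtain ⟨hD, -, -, hreg, n, P, hP, hfr⟩ := h
  have hf := frontier_compl_closure hD hreg
  refine isModelAt_of_polygon isClosed_closure.isOpen_compl ?_ hP (hf.trans hfr) (hf ▸ hx)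
  rw [closure_compl, hreg, interior_compl]

/-- Bounded open sets of the plane which near each frontier point are a half plane or a sector. -/
structure IsPolygonalDomain (Ω : Set Plane) : Prop where
  isOpen : IsOpen Ω
  nonempty : Ω.Nonempty
  isBounded : Bornology.IsBounded Ω
  isModelAt : ∀ x ∈ frontier Ω, IsModelAt Ω x

theorem IsRegularPolytope.isPolygonalDomain {Ω : Set Plane} (h : IsRegularPolytope Ω) :
    IsPolygonalDomain Ω := by
  obtain ⟨N, E, I, hE, hI, hIE, hdisj, rfl⟩ := h
  have hclosed : IsClosed (⋃ i, closure (I i)) :=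
    isClosed_iUnion_of_finite fun i => isClosed_closure
  have hopen : IsOpen (E \ ⋃ i, closure (I i)) := hE.1.sdiff hclosed
  refine ⟨hopen, ?_, hE.2.2.1.subset sdiff_subset, fun x hx => ?_⟩
  -- If the holes filled the outer disk, it would be nonempty and clopen, hence the whole plane,
  -- contradicting boundedness.
  · by_contra hemp
    rw [not_nonempty_iff_eq_empty, sdiff_eq_empty] at hemp
    have heq : E = ⋃ i, closure (I i) := hemp.antisymm (iUnion_subset hIE)
    have huniv : E = univ :=
      IsClopen.eq_univ ⟨by rw [heq]; exact hclosed, hE.1⟩ hE.2.1.nonempty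
    have hb := hE.2.2.1
    rw [huniv] at hb
    exact NormedSpace.unbounded_univ ℝ Plane hb
  · have hxn : x ∉ E \ ⋃ i, closure (I i) := by
      have := hx.2; rwa [hopen.interior_eq] at this
    have hxE : x ∈ closure E := closure_mono sdiff_subset hx.1
    by_cases hxE' : x ∈ E
    · have hxI : x ∈ ⋃ i, closure (I i) := by
        by_contra hcon; exact hxn ⟨hxE', hcon⟩
      obtain ⟨i, hi⟩ := mem_iUnion.1 hxI
      have hxi : x ∈ frontier (I i) := by
        refine ⟨hi, fun hint => ?_⟩
        obtain ⟨y, hy1, hy2⟩ := mem_closure_iff.1 hx.1 _ isOpen_interior hint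
        exact hy2.2 (mem_iUnion.2 ⟨i, subset_closure (interior_subset hy1)⟩)
      have hclosed' : IsClosed (⋃ j ∈ {j | j ≠ i}, closure (I j)) :=
        (toFinite _).isClosed_biUnion fun i _ => isClosed_closure
      have hx' : x ∉ ⋃ j ∈ {j | j ≠ i}, closure (I j) := by
        intro h
        simp only [mem_iUnion] at h
        obtain ⟨j, hj, hxj⟩ := h
        exact (hdisj j i hj).le_bot ⟨hxj, hi⟩
      refine ((hI i).isModelAt_compl hxi).congr
        (inter_mem (hE.1.mem_nhds hxE') (hclosed'.isOpen_compl.mem_nhds hx')) ?_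
      rintro y ⟨hy1, hy2⟩
      simp only [mem_compl_iff, mem_iUnion, not_exists] at hy2
      simp only [mem_compl_iff, Set.mem_sdiff, hy1, true_and, mem_iUnion, not_exists]
      constructor
      · intro h j
        by_cases hj : j = i
        · subst hj; exact h
        · exact hy2 j hj
      · exact fun h => h i
    · have hxI : x ∉ ⋃ i, closure (I i) := fun h => hxE' (iUnion_subset hIE h)
      refine (hE.isModelAt ⟨hxE, fun h => hxE' (interior_subset h)⟩).congr
        (hclosed.isOpen_compl.mem_nhds hxI) fun y hy => ?_
      exact ⟨fun h => ⟨h, hy⟩, fun h => h.1⟩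

/-! ### Regular frontier points and corners -/

theorem IsOutwardNormal.ne_zero {Ω : Set Plane} {x n : Plane} (h : IsOutwardNormal Ω x n) :
    n ≠ 0 := by
  rintro rfl
  simpa using h.1

theorem IsOutwardNormal.notMem {Ω : Set Plane} {x n : Plane} (h : IsOutwardNormal Ω x n) :
    x ∉ Ω := by
  obtain ⟨-, r, hr, hb⟩ := h
  rw [hb x (Metric.mem_ball_self hr)]
  simp

theorem IsOutwardNormal.mem_frontier {Ω : Set Plane} {x n : Plane}
    (h : IsOutwardNormal Ω x n) : x ∈ frontier Ω := by
  refine ⟨?_, fun hx => h.notMem (interior_subset hx)⟩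
  obtain ⟨hn, r, hr, hb⟩ := h
  rw [mem_closure_iff_nhds]
  intro t ht
  obtain ⟨δ, h1, h2⟩ := ((eventually_add_smul_mem x (-n)
    (inter_mem ht (Metric.ball_mem_nhds x hr))).and self_mem_nhdsWithin).exists
  have h2 : 0 < δ := h2
  refine ⟨_, h1.1, (hb _ h1.2).2 ?_⟩
  rw [add_sub_cancel_left, inner_smul_left, inner_neg_left, real_inner_self_eq_norm_sq, hn]
  simpa using h2

theorem isOutwardNormal_of_mem {Ω V : Set Plane} {x y m : Plane} (hm : m ≠ 0) (hV : IsOpen V)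
    (h : ∀ z ∈ V, (z ∈ Ω ↔ inner ℝ (z - x) m < 0)) (hy : y ∈ V) (hyx : inner ℝ (y - x) m = 0) :
    IsOutwardNormal Ω y (‖m‖⁻¹ • m) := by
  have hm0 : 0 < ‖m‖ := norm_pos_iff.2 hm
  obtain ⟨r, hr, hball⟩ := Metric.isOpen_iff.1 hV y hy
  refine ⟨by rw [norm_smul, norm_inv, norm_norm, inv_mul_cancel₀ hm0.ne'], r, hr,
    fun z hz => ?_⟩
  have e : inner ℝ (z - x) m = inner ℝ (z - y) m := by
    rw [← sub_add_sub_cancel z y x, inner_add_left, hyx, add_zero]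
  rw [h z (hball hz), inner_smul_right, e]
  constructor
  · exact fun h => mul_neg_of_pos_of_neg (inv_pos.2 hm0) h
  · intro h
    by_contra hcon
    push Not at hcon
    exact absurd h (not_lt.2 (mul_nonneg (inv_pos.2 hm0).le hcon))

theorem isOpen_inner_lt (x m : Plane) : IsOpen {y : Plane | inner ℝ (y - x) m < 0} :=
  isOpen_lt (by fun_prop) continuous_const

theorem isOpen_inner_gt (x m : Plane) : IsOpen {y : Plane | 0 < inner ℝ (y - x) m} :=
  isOpen_lt continuous_const (by fun_prop)

theorem IsOutwardNormal.eventually_mem_frontier_iff {Ω : Set Plane} (hΩ : IsOpen Ω)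
    {x n : Plane} (h : IsOutwardNormal Ω x n) :
    ∀ᶠ y in 𝓝 x, (y ∈ frontier Ω ↔ inner ℝ (y - x) n = 0) := by
  have hn0 := h.ne_zero
  obtain ⟨hn, r, hr, hb⟩ := h
  filter_upwards [Metric.ball_mem_nhds x hr] with y hy
  constructor
  · intro hyf
    have hyΩ : y ∉ Ω := by have := hyf.2; rwa [hΩ.interior_eq] at this
    rw [hb y hy, not_lt] at hyΩ
    by_contra hne
    have hpos := lt_of_le_of_ne hyΩ (Ne.symm hne)
    obtain ⟨z, ⟨hz1, hz2⟩, hz3⟩ := mem_closure_iff.1 hyf.1 _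
      (Metric.isOpen_ball.inter (isOpen_inner_gt x n)) ⟨hy, hpos⟩
    exact lt_asymm ((hb z hz1).1 hz3) hz2
  · intro h0
    exact (isOutwardNormal_of_mem hn0 Metric.isOpen_ball hb hy h0).mem_frontier

/-- The point `x` may be a corner, so `V` need not contain it. The normal component vanishes at the
nearby regular points `x + t • w` of the edge and passes to the limit by continuity up to the
boundary. -/
theorem MemU0.inner_eq_zero_of_edge {Ω V : Set Plane} {φ : Plane → Plane} (hφ : MemU0 Ω φ)
    {x m w : Plane} (hx : x ∈ closure Ω) (hm : m ≠ 0) (hV : IsOpen V)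
    (h : ∀ z ∈ V, (z ∈ Ω ↔ inner ℝ (z - x) m < 0)) (hw : inner ℝ w m = 0)
    (hwV : ∀ᶠ t : ℝ in 𝓝[>] 0, x + t • w ∈ V) : inner ℝ (φ x) m = 0 := by
  have hreg : ∀ᶠ t : ℝ in 𝓝[>] 0, IsOutwardNormal Ω (x + t • w) (‖m‖⁻¹ • m) :=
    hwV.mono fun t ht => isOutwardNormal_of_mem hm hV h ht (by
      rw [add_sub_cancel_left, inner_smul_left, hw, mul_zero])
  have hzero : ∀ᶠ t : ℝ in 𝓝[>] 0, inner ℝ (φ (x + t • w)) m = 0 := hreg.mono fun t ht => by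
    have := hφ.2 _ ht.mem_frontier _ ht
    rw [inner_smul_right] at this
    exact (mul_eq_zero.1 this).resolve_left (inv_ne_zero (norm_ne_zero_iff.2 hm))
  have hlim0 : Tendsto (fun t : ℝ => x + t • w) (𝓝[>] 0) (𝓝[closure Ω] x) := by
    refine tendsto_nhdsWithin_iff.2 ⟨?_, hreg.mono fun t ht => ht.mem_frontier.1⟩
    have : ContinuousAt (fun t : ℝ => x + t • w) 0 := by fun_prop
    simpa using this.tendsto.mono_left (nhdsWithin_le_nhds (s := Ioi 0))
  have hlim : Tendsto (fun t : ℝ => (inner ℝ (φ (x + t • w)) m : ℝ)) (𝓝[>] 0)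
      (𝓝 (inner ℝ (φ x) m)) :=
    ((hφ.1.2.1 x hx).tendsto.comp hlim0).inner tendsto_const_nhds
  exact tendsto_nhds_unique hlim (tendsto_const_nhds.congr' (hzero.mono fun t ht => ht.symm))

/-- The limits along the two edges make the value orthogonal to two independent normals. For a
convex sector each edge borders the negative side of the other normal, for a reflex sector the
positive side. -/
theorem MemU0.eq_zero_of_corner {Ω : Set Plane} {φ : Plane → Plane} (hφ : MemU0 Ω φ) {x : Plane}
    (hx : x ∈ closure Ω) (hc : IsCornerAt Ω x) : φ x = 0 := by
  obtain ⟨m₁, m₂, hm, r, hr, h⟩ := hc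
  have hball : IsOpen (Metric.ball x r) := Metric.isOpen_ball
  have hm1 : m₁ ≠ 0 := by rintro rfl; simp [cross] at hm
  have hm2 : m₂ ≠ 0 := by rintro rfl; simp [cross] at hm
  have hev : ∀ w, ∀ᶠ t : ℝ in 𝓝[>] 0, x + t • w ∈ Metric.ball x r := fun w =>
    eventually_add_smul_mem x w (Metric.ball_mem_nhds x hr)
  rcases h with h | h
  · obtain ⟨w1, hw11, hw12⟩ := exists_inner_eq hm 0 (-1)
    obtain ⟨w2, hw21, hw22⟩ := exists_inner_eq hm (-1) 0
    refine eq_of_inner_eq hm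
      (hφ.inner_eq_zero_of_edge hx hm1 (hball.inter (isOpen_inner_lt x m₂)) ?_ hw11 ?_)
      (hφ.inner_eq_zero_of_edge hx hm2 (hball.inter (isOpen_inner_lt x m₁)) ?_ hw22 ?_)
    · rintro z ⟨hz1, hz2⟩; rw [h z hz1]; exact and_iff_left hz2
    · filter_upwards [hev w1, self_mem_nhdsWithin] with t ht ht0
      have ht0 : 0 < t := ht0
      exact ⟨ht, by simp [inner_smul_left, hw12, ht0]⟩
    · rintro z ⟨hz1, hz2⟩; rw [h z hz1]; exact and_iff_right hz2
    · filter_upwards [hev w2, self_mem_nhdsWithin] with t ht ht0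
      have ht0 : 0 < t := ht0
      exact ⟨ht, by simp [inner_smul_left, hw21, ht0]⟩
  · obtain ⟨w1, hw11, hw12⟩ := exists_inner_eq hm 0 1
    obtain ⟨w2, hw21, hw22⟩ := exists_inner_eq hm 1 0
    refine eq_of_inner_eq hm
      (hφ.inner_eq_zero_of_edge hx hm1 (hball.inter (isOpen_inner_gt x m₂)) ?_ hw11 ?_)
      (hφ.inner_eq_zero_of_edge hx hm2 (hball.inter (isOpen_inner_gt x m₁)) ?_ hw22 ?_)
    · rintro z ⟨hz1, hz2⟩; rw [h z hz1]; exact or_iff_left (lt_asymm hz2)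
    · filter_upwards [hev w1, self_mem_nhdsWithin] with t ht ht0
      have ht0 : 0 < t := ht0
      exact ⟨ht, by simp [inner_smul_left, hw12, ht0]⟩
    · rintro z ⟨hz1, hz2⟩; rw [h z hz1]; exact or_iff_right (lt_asymm hz2)
    · filter_upwards [hev w2, self_mem_nhdsWithin] with t ht ht0
      have ht0 : 0 < t := ht0
      exact ⟨ht, by simp [inner_smul_left, hw21, ht0]⟩

/-! ### Fields of class `C¹` up to the boundary are Lipschitz -/

/-- Cramer's rule in quantitative form. -/
theorem norm_le_of_cross {m₁ m₂ : Plane} (hm : cross m₁ m₂ ≠ 0) (w : Plane) :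
    ‖w‖ ≤ |cross m₁ m₂|⁻¹ * (|inner ℝ w m₁| * ‖m₂‖ + |inner ℝ w m₂| * ‖m₁‖) := by
  have e : cross m₁ m₂ • w = (-inner ℝ w m₁ : ℝ) • rot m₂ + (inner ℝ w m₂ : ℝ) • rot m₁ := by
    rw [inner_eq, inner_eq]
    apply plane_ext <;>
    · simp only [PiLp.add_apply, PiLp.smul_apply, smul_eq_mul, rot, cross, Matrix.cons_val_zero,
        Matrix.cons_val_one]
      ring
  have h0 : 0 < |cross m₁ m₂| := abs_pos.2 hm
  rw [← mul_le_mul_iff_right₀ h0, ← mul_assoc, mul_inv_cancel₀ h0.ne', one_mul,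
    ← Real.norm_eq_abs, ← norm_smul, e]
  refine (norm_add_le _ _).trans ?_
  simp [norm_smul, norm_rot]

/-- Both pairings have opposite signs at `v` and `w`, so their absolute values add up in the
pairings of `v - w`. Hence a detour through the apex of a reflex sector costs only a constant
factor. -/
theorem norm_le_of_opposite {m₁ m₂ : Plane} (hm : cross m₁ m₂ ≠ 0) :
    ∃ C : ℝ, 0 ≤ C ∧ ∀ v w : Plane, inner ℝ v m₁ < 0 → 0 ≤ inner ℝ w m₁ → 0 ≤ inner ℝ v m₂ →
      inner ℝ w m₂ < 0 → ‖v‖ + ‖w‖ ≤ C * ‖v - w‖ := by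
  refine ⟨|cross m₁ m₂|⁻¹ * (2 * ‖m₁‖ * ‖m₂‖), by positivity, fun v w h1 h2 h3 h4 => ?_⟩
  have e1 : |inner ℝ v m₁| + |inner ℝ w m₁| ≤ ‖v - w‖ * ‖m₁‖ := by
    have := abs_real_inner_le_norm (v - w) m₁
    rw [inner_sub_left, abs_of_neg (by linarith)] at this
    rw [abs_of_neg h1, abs_of_nonneg h2]; linarith
  have e2 : |inner ℝ v m₂| + |inner ℝ w m₂| ≤ ‖v - w‖ * ‖m₂‖ := by
    have := abs_real_inner_le_norm (v - w) m₂
    rw [inner_sub_left, abs_of_pos (by linarith)] at this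
    rw [abs_of_neg h4, abs_of_nonneg h3]; linarith
  calc ‖v‖ + ‖w‖ ≤ |cross m₁ m₂|⁻¹ * (|inner ℝ v m₁| * ‖m₂‖ + |inner ℝ v m₂| * ‖m₁‖) +
        |cross m₁ m₂|⁻¹ * (|inner ℝ w m₁| * ‖m₂‖ + |inner ℝ w m₂| * ‖m₁‖) :=
        add_le_add (norm_le_of_cross hm v) (norm_le_of_cross hm w)
    _ = |cross m₁ m₂|⁻¹ * ((|inner ℝ v m₁| + |inner ℝ w m₁|) * ‖m₂‖ +
        (|inner ℝ v m₂| + |inner ℝ w m₂|) * ‖m₁‖) := by ring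
    _ ≤ |cross m₁ m₂|⁻¹ * ((‖v - w‖ * ‖m₁‖) * ‖m₂‖ + (‖v - w‖ * ‖m₂‖) * ‖m₁‖) := by gcongr
    _ = _ := by ring

theorem IsPolygonalDomain.isCompact_closure {Ω : Set Plane} (hΩ : IsPolygonalDomain Ω) :
    IsCompact (closure Ω) := hΩ.isBounded.isCompact_closure

theorem IsC1UpToBoundary.exists_norm_fderiv_le {Ω : Set Plane} (hΩ : IsPolygonalDomain Ω)
    {φ : Plane → Plane} (hφ : IsC1UpToBoundary Ω φ) :
    ∃ K : ℝ≥0, ∀ x ∈ Ω, ‖fderiv ℝ φ x‖₊ ≤ K := by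
  obtain ⟨-, -, G, hG, hφG⟩ := hφ
  obtain ⟨C, hC⟩ := hΩ.isCompact_closure.exists_bound_of_continuousOn hG
  refine ⟨C.toNNReal, fun x hx => ?_⟩
  rw [hφG x hx, ← NNReal.coe_le_coe, coe_nnnorm]
  exact (hC x (subset_closure hx)).trans (Real.le_coe_toNNReal C)

theorem IsC1UpToBoundary.differentiableAt {Ω : Set Plane} (hΩ : IsOpen Ω)
    {φ : Plane → Plane} (hφ : IsC1UpToBoundary Ω φ) {x : Plane} (hx : x ∈ Ω) :
    DifferentiableAt ℝ φ x :=
  (hφ.1.differentiableOn one_ne_zero).differentiableAt (hΩ.mem_nhds hx)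

/-- Two points in a common half disc are compared directly. Otherwise they are compared through the
apex, which lies in the closure of both half discs. -/
theorem lipschitzOnWith_union_sectors {φ : Plane → Plane} {x m₁ m₂ : Plane}
    (hm : cross m₁ m₂ ≠ 0) {r : ℝ} (hr : 0 < r) {K : ℝ≥0}
    (h1 : LipschitzOnWith K φ (Metric.ball x r ∩ {y | inner ℝ (y - x) m₁ < 0}))
    (h2 : LipschitzOnWith K φ (Metric.ball x r ∩ {y | inner ℝ (y - x) m₂ < 0}))
    (hc1 : ContinuousOn φ (closure (Metric.ball x r ∩ {y | inner ℝ (y - x) m₁ < 0})))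
    (hc2 : ContinuousOn φ (closure (Metric.ball x r ∩ {y | inner ℝ (y - x) m₂ < 0}))) :
    ∃ K' : ℝ≥0, LipschitzOnWith K' φ (Metric.ball x r ∩
      {y | inner ℝ (y - x) m₁ < 0 ∨ inner ℝ (y - x) m₂ < 0}) := by
  have hmem : ∀ (m w : Plane), inner ℝ w m = -1 →
      x ∈ closure (Metric.ball x r ∩ {y | inner ℝ (y - x) m < 0}) := by
    intro m w hw
    rw [mem_closure_iff_nhds]
    intro t ht
    obtain ⟨δ, hδ, hδ0⟩ := ((eventually_add_smul_mem x w
      (inter_mem ht (Metric.ball_mem_nhds x hr))).and self_mem_nhdsWithin).exists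
    have hδ0 : 0 < δ := hδ0
    exact ⟨_, hδ.1, hδ.2, by simp [inner_smul_left, hw, hδ0]⟩
  obtain ⟨w, hw1, hw2⟩ := exists_inner_eq hm (-1) (-1)
  have h1' := LipschitzOnWith.closure hc1 h1
  have h2' := LipschitzOnWith.closure hc2 h2
  obtain ⟨C, hC, hopp⟩ := norm_le_of_opposite hm
  have key : ∀ y ∈ Metric.ball x r, ∀ z ∈ Metric.ball x r, inner ℝ (y - x) m₁ < 0 →
      0 ≤ inner ℝ (z - x) m₁ → 0 ≤ inner ℝ (y - x) m₂ → inner ℝ (z - x) m₂ < 0 →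
      dist (φ y) (φ z) ≤ K * C * dist y z := by
    intro y hy z hz e1 e2 e3 e4
    have d1 := h1'.dist_le_mul y (subset_closure ⟨hy, e1⟩) x (hmem m₁ w hw1)
    have d2 := h2'.dist_le_mul z (subset_closure ⟨hz, e4⟩) x (hmem m₂ w hw2)
    have d3 := hopp (y - x) (z - x) e1 e2 e3 e4
    rw [sub_sub_sub_cancel_right, ← dist_eq_norm, ← dist_eq_norm, ← dist_eq_norm] at d3
    calc dist (φ y) (φ z) ≤ dist (φ y) (φ x) + dist (φ z) (φ x) := dist_triangle_right _ _ _
      _ ≤ K * (dist y x + dist z x) := by linarith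
      _ ≤ K * (C * dist y z) := by gcongr
      _ = _ := by ring
  refine ⟨(K + K * C).toNNReal, LipschitzOnWith.of_dist_le_mul ?_⟩
  rw [Real.coe_toNNReal _ (by positivity)]
  rintro y ⟨hy, hy'⟩ z ⟨hz, hz'⟩
  have hKC : (0 : ℝ) ≤ K * C := by positivity
  have b1 : (K : ℝ) * dist y z ≤ (K + K * C) * dist y z := by gcongr; linarith
  have b2 : (K : ℝ) * C * dist y z ≤ (K + K * C) * dist y z := by gcongr; simp
  by_cases hy1 : inner ℝ (y - x) m₁ < 0 <;> by_cases hz1 : inner ℝ (z - x) m₁ < 0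
  · exact (h1.dist_le_mul y ⟨hy, hy1⟩ z ⟨hz, hz1⟩).trans b1
  · have hz2 := hz'.resolve_left hz1
    by_cases hy2 : inner ℝ (y - x) m₂ < 0
    · exact (h2.dist_le_mul y ⟨hy, hy2⟩ z ⟨hz, hz2⟩).trans b1
    · exact (key y hy z hz hy1 (not_lt.1 hz1) (not_lt.1 hy2) hz2).trans b2
  · have hy2 := hy'.resolve_left hy1
    by_cases hz2 : inner ℝ (z - x) m₂ < 0
    · exact (h2.dist_le_mul y ⟨hy, hy2⟩ z ⟨hz, hz2⟩).trans b1
    · rw [dist_comm, dist_comm y z] at *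
      exact (key z hz y hy hz1 (not_lt.1 hy1) (not_lt.1 hz2) hy2).trans b2
  · exact (h2.dist_le_mul y ⟨hy, hy'.resolve_left hy1⟩ z ⟨hz, hz'.resolve_left hz1⟩).trans b1

/-- The derivative bound gives Lipschitz estimates on convex pieces only. Locally the domain is
convex or a reflex sector, and compactness of the closure turns the local estimates into a global
one. -/
theorem IsC1UpToBoundary.exists_lipschitzOnWith {Ω : Set Plane} (hΩ : IsPolygonalDomain Ω)
    {φ : Plane → Plane} (hφ : IsC1UpToBoundary Ω φ) :
    ∃ K : ℝ≥0, LipschitzOnWith K φ (closure Ω) := by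
  obtain ⟨K, hK⟩ := hφ.exists_norm_fderiv_le hΩ
  have hconv : ∀ s ⊆ Ω, Convex ℝ s → LipschitzOnWith K φ s := fun s hs hc =>
    hc.lipschitzOnWith_of_nnnorm_fderiv_le (fun y hy => hφ.differentiableAt hΩ.isOpen (hs hy))
      fun y hy => hK y (hs hy)
  have hlocal : ∀ x ∈ closure Ω, ∃ r > 0, ∃ K' : ℝ≥0,
      LipschitzOnWith K' φ (Metric.ball x r ∩ Ω) := by
    intro x hx
    by_cases hxΩ : x ∈ Ω
    · obtain ⟨r, hr, hb⟩ := Metric.isOpen_iff.1 hΩ.isOpen x hxΩ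
      exact ⟨r, hr, K, (hconv _ hb (convex_ball x r)).mono inter_subset_left⟩
    rcases hΩ.isModelAt x ⟨hx, fun h => hxΩ (interior_subset h)⟩ with
      ⟨n, -, r, hr, hb⟩ | ⟨m₁, m₂, hm, r, hr, hb | hb⟩
    · refine ⟨r, hr, K, ?_⟩
      have e : Metric.ball x r ∩ Ω = Metric.ball x r ∩ {y | inner ℝ (y - x) n < 0} := by
        ext y; exact and_congr_right (hb y)
      refine hconv _ inter_subset_right ?_
      rw [e]
      exact (convex_ball x r).inter (convex_inner_lt x n)
    · refine ⟨r, hr, K, ?_⟩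
      have e : Metric.ball x r ∩ Ω = Metric.ball x r ∩
          ({y | inner ℝ (y - x) m₁ < 0} ∩ {y | inner ℝ (y - x) m₂ < 0}) := by
        ext y; exact and_congr_right (hb y)
      refine hconv _ inter_subset_right ?_
      rw [e]
      exact (convex_ball x r).inter ((convex_inner_lt x m₁).inter (convex_inner_lt x m₂))
    · have e : Metric.ball x r ∩ Ω = Metric.ball x r ∩
          {y | inner ℝ (y - x) m₁ < 0 ∨ inner ℝ (y - x) m₂ < 0} := by
        ext y; exact and_congr_right (hb y)
      have s1 : Metric.ball x r ∩ {y | inner ℝ (y - x) m₁ < 0} ⊆ Ω := fun y hy =>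
        (hb y hy.1).2 (Or.inl hy.2)
      have s2 : Metric.ball x r ∩ {y | inner ℝ (y - x) m₂ < 0} ⊆ Ω := fun y hy =>
        (hb y hy.1).2 (Or.inr hy.2)
      refine ⟨r, hr, ?_⟩
      rw [e]
      exact lipschitzOnWith_union_sectors hm hr
        (hconv _ s1 ((convex_ball x r).inter (convex_inner_lt x m₁)))
        (hconv _ s2 ((convex_ball x r).inter (convex_inner_lt x m₂)))
        (hφ.2.1.mono (closure_mono s1)) (hφ.2.1.mono (closure_mono s2))
  apply LocallyLipschitzOn.exists_lipschitzOnWith_of_compact hΩ.isCompact_closure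
  intro x hx
  obtain ⟨r, hr, K', hK'⟩ := hlocal x hx
  -- As the ball is open, this closure contains the part of `closure Ω` inside the ball, so it is a
  -- relative neighbourhood of `x`.
  refine ⟨K', closure (Metric.ball x r ∩ Ω), ?_,
    LipschitzOnWith.closure (hφ.2.1.mono (closure_mono inter_subset_right)) hK'⟩
  rw [mem_nhdsWithin]
  exact ⟨_, Metric.isOpen_ball, Metric.mem_ball_self hr, Metric.isOpen_ball.inter_closure⟩

/-! ### Tangential fields along the boundary -/

theorem IsPolygonalDomain.isCompact_frontier {Ω : Set Plane} (hΩ : IsPolygonalDomain Ω) :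
    IsCompact (frontier Ω) :=
  hΩ.isCompact_closure.of_isClosed_subset isClosed_frontier frontier_subset_closure

theorem IsOutwardNormal.inner_eq_zero_of_frequently {Ω : Set Plane} (hΩ : IsOpen Ω)
    {x n w : Plane} (h : IsOutwardNormal Ω x n)
    (hw : ∃ᶠ t : ℝ in 𝓝[>] 0, x + t • w ∈ frontier Ω) : inner ℝ w n = 0 := by
  obtain ⟨t, ht, ht1, ht0⟩ := (hw.and_eventually ((eventually_add_smul_mem x w
    (h.eventually_mem_frontier_iff hΩ)).and self_mem_nhdsWithin)).exists
  have ht0 : 0 < t := ht0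
  have := (show _ ↔ _ from ht1).1 ht
  rw [add_sub_cancel_left, inner_smul_left] at this
  exact (mul_eq_zero.1 this).resolve_left ht0.ne'

theorem IsOutwardNormal.eventually_mem_frontier {Ω : Set Plane} (hΩ : IsOpen Ω)
    {x n w : Plane} (h : IsOutwardNormal Ω x n) (hw : inner ℝ w n = 0) :
    ∀ᶠ t : ℝ in 𝓝[>] 0, x + t • w ∈ frontier Ω := by
  filter_upwards [eventually_add_smul_mem x w (h.eventually_mem_frontier_iff hΩ)] with t ht
  refine (show _ ↔ _ from ht).2 ?_
  rw [add_sub_cancel_left, inner_smul_left, hw, mul_zero]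

theorem eventually_lt_nhdsGT {a : ℝ} (ha : 0 < a) : ∀ᶠ t : ℝ in 𝓝[>] 0, 0 < t ∧ t < a := by
  filter_upwards [self_mem_nhdsWithin, Ioo_mem_nhdsGT ha] with t ht ht2
  exact ht2

/-- From a regular frontier point one can follow the frontier along the tangent until one meets
a corner. -/
theorem IsPolygonalDomain.exists_edge {Ω : Set Plane} (hΩ : IsPolygonalDomain Ω) {y n τ : Plane}
    (hy : IsOutwardNormal Ω y n) (hτ : ‖τ‖ = 1) (hτn : inner ℝ τ n = 0) :
    ∃ s : ℝ, 0 < s ∧ (∀ t ∈ Icc 0 s, y + t • τ ∈ frontier Ω) ∧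
      (∀ t ∈ Icc 0 s, IsCornerAt Ω (y + t • τ) ∨
        ∃ n', IsOutwardNormal Ω (y + t • τ) n' ∧ inner ℝ τ n' = 0) ∧
      IsCornerAt Ω (y + s • τ) := by
  set S : Set ℝ := {s | 0 ≤ s ∧ ∀ t ∈ Icc 0 s, y + t • τ ∈ frontier Ω} with hS
  have h0S : (0 : ℝ) ∈ S := ⟨le_rfl, fun t ht => by
    rw [Icc_self, mem_singleton_iff] at ht
    simpa [ht] using hy.mem_frontier⟩
  obtain ⟨R, hR⟩ := hΩ.isCompact_frontier.isBounded.exists_norm_le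
  have hbdd : BddAbove S := ⟨R + ‖y‖, fun s hs => by
    have h1 := hR _ (hs.2 s ⟨hs.1, le_rfl⟩)
    have h2 : ‖s • τ‖ ≤ ‖y + s • τ‖ + ‖y‖ := by
      have := norm_sub_le (y + s • τ) y
      rwa [add_sub_cancel_left] at this
    rw [norm_smul, hτ, mul_one, Real.norm_eq_abs] at h2
    linarith [le_abs_self s]⟩
  set s := sSup S with hs
  have hs0 : 0 ≤ s := le_csSup hbdd h0S
  have hclosed : IsClosed {t : ℝ | y + t • τ ∈ frontier Ω} :=
    isClosed_frontier.preimage (by fun_prop)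
  have hsf : y + s • τ ∈ frontier Ω := by
    have h1 : closure S ⊆ {t : ℝ | y + t • τ ∈ frontier Ω} :=
      closure_minimal (fun t ht => ht.2 t ⟨ht.1, le_rfl⟩) hclosed
    exact h1 (csSup_mem_closure ⟨0, h0S⟩ hbdd)
  have hf : ∀ t ∈ Icc 0 s, y + t • τ ∈ frontier Ω := by
    intro t ht
    rcases ht.2.eq_or_lt with h | h
    · rwa [h]
    · obtain ⟨s', hs', hlt⟩ := exists_lt_of_lt_csSup ⟨0, h0S⟩ h
      exact hs'.2 t ⟨ht.1, hlt.le⟩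
  -- A regular endpoint with tangent `τ` would let the segment be prolonged beyond the supremum.
  have hmax : ∀ n', IsOutwardNormal Ω (y + s • τ) n' → inner ℝ τ n' ≠ 0 := by
    intro n' hn' h0
    have h1 := hn'.eventually_mem_frontier hΩ.isOpen h0
    obtain ⟨ε, hε, h2⟩ := mem_nhdsGT_iff_exists_Ioo_subset.1 h1
    have hε : 0 < ε := hε
    have h3 : s + ε / 2 ∈ S := by
      refine ⟨by linarith, fun t ht => ?_⟩
      rcases le_or_gt t s with hts | hts
      · exact hf t ⟨ht.1, hts⟩
      · have h4 : t - s ∈ Ioo 0 ε := ⟨by linarith, by linarith [ht.2]⟩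
        have h5 : y + s • τ + (t - s) • τ ∈ frontier Ω := h2 h4
        convert h5 using 1
        module
    linarith [le_csSup hbdd h3]
  have hspos : 0 < s := by
    rcases hs0.eq_or_lt with h | h
    · exact absurd hτn (hmax n (by rw [← h]; simpa using hy))
    · exact h
  -- The frontier contains points along `τ` arbitrarily near, ahead when `t < s` and behind when `t
  -- = s`, so every normal is orthogonal to `τ`. With `hmax`, the endpoint can only be a corner.
  have htan : ∀ t ∈ Icc 0 s, ∀ n', IsOutwardNormal Ω (y + t • τ) n' → inner ℝ τ n' = 0 := by
    intro t ht n' hn'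
    rcases ht.2.eq_or_lt with h | h
    · have h1 : ∀ᶠ δ : ℝ in 𝓝[>] 0, y + t • τ + δ • (-τ) ∈ frontier Ω := by
        filter_upwards [eventually_lt_nhdsGT hspos] with δ hδ
        have := hf (t - δ) ⟨by linarith, by linarith⟩
        convert this using 1
        module
      have := hn'.inner_eq_zero_of_frequently hΩ.isOpen h1.frequently
      rwa [inner_neg_left, neg_eq_zero] at this
    · have h1 : ∀ᶠ δ : ℝ in 𝓝[>] 0, y + t • τ + δ • τ ∈ frontier Ω := by
        filter_upwards [eventually_lt_nhdsGT (sub_pos.2 h)] with δ hδ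
        have := hf (t + δ) ⟨by linarith [ht.1], by linarith⟩
        convert this using 1
        module
      exact hn'.inner_eq_zero_of_frequently hΩ.isOpen h1.frequently
  refine ⟨s, hspos, hf, fun t ht => ?_, ?_⟩
  · rcases hΩ.isModelAt _ (hf t ht) with ⟨n', hn'⟩ | h
    · exact Or.inr ⟨n', hn', htan t ht n' hn'⟩
    · exact Or.inl h
  · rcases hΩ.isModelAt _ hsf with ⟨n', hn'⟩ | h
    · exact absurd (htan s ⟨hs0, le_rfl⟩ n' hn') (hmax n' hn')
    · exact h

theorem MemU0.eq_smul_of_edge {Ω : Set Plane} {φ : Plane → Plane} (hφ : MemU0 Ω φ)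
    {z τ : Plane} (hτ : ‖τ‖ = 1) (hz : z ∈ frontier Ω)
    (h : IsCornerAt Ω z ∨ ∃ n', IsOutwardNormal Ω z n' ∧ inner ℝ τ n' = 0) :
    φ z = (inner ℝ (φ z) τ : ℝ) • τ := by
  rcases h with h | ⟨n', hn', h0⟩
  · rw [hφ.eq_zero_of_corner hz.1 h]; simp
  · exact eq_smul_of_inner_eq_zero hn'.ne_zero (hφ.2 z hz n' hn') h0 hτ

/-- Following the edge in both directions ends at corners. This reduces the field on the edge to a
scalar function vanishing at both ends. -/
theorem MemU0.exists_chord {Ω : Set Plane} (hΩ : IsPolygonalDomain Ω) {φ : Plane → Plane}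
    (hφ : MemU0 Ω φ) {y n : Plane} (hy : IsOutwardNormal Ω y n) :
    ∃ (τ : Plane) (a b : ℝ), ‖τ‖ = 1 ∧ a < 0 ∧ 0 < b ∧
      (∀ t ∈ Icc a b, y + t • τ ∈ frontier Ω ∧
        φ (y + t • τ) = (inner ℝ (φ (y + t • τ)) τ : ℝ) • τ) ∧
      φ (y + a • τ) = 0 ∧ φ (y + b • τ) = 0 := by
  have hτ : ‖rot n‖ = 1 := by rw [norm_rot, hy.1]
  have hτn : inner ℝ (rot n) n = 0 := by
    rw [real_inner_comm, inner_rot]; simp [cross, mul_comm]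
  obtain ⟨b, hb, hbf, hbt, hbc⟩ := hΩ.exists_edge hy hτ hτn
  obtain ⟨a, ha, haf, hat, hac⟩ := hΩ.exists_edge hy (τ := -rot n) (by rwa [norm_neg])
    (by rw [inner_neg_left, hτn, neg_zero])
  refine ⟨rot n, -a, b, hτ, neg_lt_zero.2 ha, hb, fun t ht => ?_, ?_, ?_⟩
  · rcases le_or_gt 0 t with h | h
    · exact ⟨hbf t ⟨h, ht.2⟩, hφ.eq_smul_of_edge hτ (hbf t ⟨h, ht.2⟩) (hbt t ⟨h, ht.2⟩)⟩
    · have h1 : -t ∈ Icc 0 a := ⟨by linarith, by linarith [ht.1]⟩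
      have e : y + t • rot n = y + (-t) • (-rot n) := by module
      have h2 := haf _ h1
      have h3 := hφ.eq_smul_of_edge (τ := -rot n) (by rwa [norm_neg]) h2 (hat _ h1)
      rw [e]
      refine ⟨h2, h3.trans ?_⟩
      rw [inner_neg_right]
      module
  · have e : y + (-a) • rot n = y + a • (-rot n) := by module
    rw [e]
    exact hφ.eq_zero_of_corner (haf a ⟨ha.le, le_rfl⟩).1 hac
  · exact hφ.eq_zero_of_corner (hbf b ⟨hb.le, le_rfl⟩).1 hbc

/-- A perturbation of the identity by a tangential contraction maps the frontier onto itself. -/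
theorem MemU0.frontier_mem_and_surj {Ω : Set Plane} (hΩ : IsPolygonalDomain Ω)
    {φ : Plane → Plane} (hφ : MemU0 Ω φ) {K : ℝ≥0} (hK : K < 1)
    (hL : LipschitzOnWith K φ (closure Ω)) {y : Plane} (hy : y ∈ frontier Ω) :
    y + φ y ∈ frontier Ω ∧ ∃ x ∈ frontier Ω, x + φ x = y := by
  rcases hΩ.isModelAt y hy with ⟨n, hn⟩ | hc
  swap
  · have := hφ.eq_zero_of_corner hy.1 hc
    exact ⟨by rwa [this, add_zero], y, hy, by rw [this, add_zero]⟩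
  obtain ⟨τ, a, b, hτ, ha, hb, hab, hφa, hφb⟩ := hφ.exists_chord hΩ hn
  set g : ℝ → ℝ := fun t => t + inner ℝ (φ (y + t • τ)) τ with hg
  have hga : g a = a := by simp [hg, hφa]
  have hgb : g b = b := by simp [hg, hφb]
  have hgΦ : ∀ t ∈ Icc a b, y + t • τ + φ (y + t • τ) = y + g t • τ := by
    intro t ht
    have := (hab t ht).2
    rw [hg]
    simp only [add_smul]
    rw [← this, add_assoc]
  have hcont : ContinuousOn g (Icc a b) := by
    refine continuousOn_id.add (ContinuousOn.inner ?_ continuousOn_const)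
    exact hφ.1.2.1.comp (by fun_prop) fun t ht => (hab t ht).1.1
  -- The scalar displacement has Lipschitz constant `K`, at most one, so it cannot reverse the
  -- order.
  have hmono : MonotoneOn g (Icc a b) := by
    intro t ht t' ht' htt
    have h1 := hL.dist_le_mul _ (hab t ht).1.1 _ (hab t' ht').1.1
    have h2 : dist (y + t • τ) (y + t' • τ) = t' - t := by
      rw [dist_add_left, dist_eq_norm, ← sub_smul, norm_smul, hτ, mul_one, Real.norm_eq_abs,
        abs_sub_comm, abs_of_nonneg (by linarith)]
    have h3 : |inner ℝ (φ (y + t • τ) - φ (y + t' • τ)) τ| ≤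
        ‖φ (y + t • τ) - φ (y + t' • τ)‖ * ‖τ‖ := abs_real_inner_le_norm _ _
    rw [h2, dist_eq_norm] at h1
    rw [hτ, mul_one, inner_sub_left] at h3
    have hK' : (K : ℝ) ≤ 1 := by exact_mod_cast hK.le
    have h4 : (K : ℝ) * (t' - t) ≤ 1 * (t' - t) :=
      mul_le_mul_of_nonneg_right hK' (by linarith)
    have h5 := (abs_le.1 (h3.trans (h1.trans h4))).2
    simp only [hg]
    linarith
  have h0 : (0 : ℝ) ∈ Icc a b := ⟨ha.le, hb.le⟩
  have hab' : a ≤ b := by linarith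
  constructor
  · have h1 := hgΦ 0 h0
    simp only [zero_smul, add_zero] at h1
    rw [h1]
    refine (hab _ ⟨?_, ?_⟩).1
    · rw [← hga]; exact hmono (left_mem_Icc.2 hab') h0 ha.le
    · rw [← hgb]; exact hmono h0 (right_mem_Icc.2 hab') hb.le
  · obtain ⟨t, ht, hgt⟩ := intermediate_value_Icc hab' hcont
      (show (0 : ℝ) ∈ Icc (g a) (g b) by rw [hga, hgb]; exact h0)
    refine ⟨_, (hab t ht).1, ?_⟩
    rw [hgΦ t ht, hgt, zero_smul, add_zero]

/-! ### Linear structure of the space of tangential fields -/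

theorem IsC1UpToBoundary.add {Ω : Set Plane} (hΩ : IsOpen Ω) {φ ψ : Plane → Plane}
    (hφ : IsC1UpToBoundary Ω φ) (hψ : IsC1UpToBoundary Ω ψ) : IsC1UpToBoundary Ω (φ + ψ) := by
  obtain ⟨G, hG, hφG⟩ := hφ.2.2
  obtain ⟨H, hH, hψH⟩ := hψ.2.2
  refine ⟨hφ.1.add hψ.1, hφ.2.1.add hψ.2.1, G + H, hG.add hH, fun x hx => ?_⟩
  rw [fderiv_add (hφ.differentiableAt hΩ hx) (hψ.differentiableAt hΩ hx), hφG x hx, hψH x hx]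
  rfl

theorem IsC1UpToBoundary.const_smul {Ω : Set Plane} (hΩ : IsOpen Ω) {φ : Plane → Plane}
    (hφ : IsC1UpToBoundary Ω φ) (c : ℝ) : IsC1UpToBoundary Ω (c • φ) := by
  obtain ⟨G, hG, hφG⟩ := hφ.2.2
  refine ⟨contDiffOn_const.smul hφ.1, hφ.2.1.const_smul c, c • G, hG.const_smul c,
    fun x hx => ?_⟩
  rw [fderiv_const_smul (hφ.differentiableAt hΩ hx), hφG x hx]
  rfl

/-- The fields of class `C¹` up to the boundary with vanishing normal component. -/
def tangentialFields (Ω : Set Plane) (hΩ : IsOpen Ω) : Submodule ℝ (Plane → Plane) where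
  carrier := {φ | MemU0 Ω φ}
  zero_mem' := ⟨⟨contDiffOn_const, continuousOn_const, 0, continuousOn_const, fun x _ => by
    simp⟩, fun x _ n _ => by simp⟩
  add_mem' := fun {φ ψ} hφ hψ => ⟨hφ.1.add hΩ hψ.1, fun x hx n hn => by
    rw [Pi.add_apply, inner_add_left, hφ.2 x hx n hn, hψ.2 x hx n hn, add_zero]⟩
  smul_mem' := fun c φ hφ => ⟨hφ.1.const_smul hΩ c, fun x hx n hn => by
    rw [Pi.smul_apply, inner_smul_left, hφ.2 x hx n hn, mul_zero]⟩

theorem MemU0.const_smul {Ω : Set Plane} (hΩ : IsOpen Ω) {φ : Plane → Plane}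
    (hφ : MemU0 Ω φ) (c : ℝ) : MemU0 Ω (c • φ) :=
  (tangentialFields Ω hΩ).smul_mem c hφ

theorem MemU0.sum {Ω : Set Plane} (hΩ : IsOpen Ω) {M : ℕ} {φ : Fin M → Plane → Plane}
    (hφ : ∀ i, MemU0 Ω (φ i)) (a : Fin M → ℝ) : MemU0 Ω (∑ i, a i • φ i) :=
  (tangentialFields Ω hΩ).sum_mem fun i _ => (hφ i).const_smul hΩ (a i)

/-! ### Small tangential perturbations of the identity are bijective -/

theorem injOn_add_of_lipschitzOnWith {S : Set Plane} {φ : Plane → Plane} {K : ℝ≥0} (hK : K < 1)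
    (hL : LipschitzOnWith K φ S) : InjOn (fun x => x + φ x) S := by
  intro x hx y hy hxy
  have hxy : x + φ x = y + φ y := hxy
  have h1 := hL.dist_le_mul x hx y hy
  have h2 : dist (φ x) (φ y) = dist x y := by
    rw [dist_eq_norm, dist_comm x y, dist_eq_norm]
    congr 1
    rw [sub_eq_sub_iff_add_eq_add, add_comm, hxy, add_comm]
  rw [h2] at h1
  have hK' : (K : ℝ) < 1 := by exact_mod_cast hK
  rw [← dist_eq_zero]
  nlinarith [dist_nonneg (x := x) (y := y)]

/-- The map approximates the identity, whose inverse has norm one, with error constant below one. -/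
theorem isOpen_image_add {U : Set Plane} (hU : IsOpen U) {φ : Plane → Plane} {K : ℝ≥0}
    (hK : K < 1) (hL : LipschitzOnWith K φ U) : IsOpen ((fun x => x + φ x) '' U) := by
  have h : ApproximatesLinearOn (fun x => x + φ x)
      ((ContinuousLinearEquiv.refl ℝ Plane : Plane ≃L[ℝ] Plane) : Plane →L[ℝ] Plane) U K := by
    intro x hx y hy
    have := hL.dist_le_mul x hx y hy
    rw [dist_eq_norm, dist_eq_norm] at this
    change ‖x + φ x - (y + φ y) - (x - y)‖ ≤ K * ‖x - y‖
    have e : x + φ x - (y + φ y) - (x - y) = φ x - φ y := by abel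
    rwa [e]
  refine h.open_image (ContinuousLinearEquiv.toNonlinearRightInverse _) hU (Or.inr ?_)
  have : (ContinuousLinearEquiv.toNonlinearRightInverse
      (ContinuousLinearEquiv.refl ℝ Plane)).nnnorm = 1 := by
    change ‖((ContinuousLinearEquiv.refl ℝ Plane).symm : Plane →L[ℝ] Plane)‖₊ = 1
    simp
  rw [this, inv_one]
  exact hK

/-- A frontier value is already attained at a frontier point by the map with displacement `t • φ`.
Injectivity would identify that point with the interior point `x`. -/
theorem MemU0.segment_notMem_frontier {Ω : Set Plane} (hΩ : IsPolygonalDomain Ω)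
    {φ : Plane → Plane} (hφ : MemU0 Ω φ) {K : ℝ≥0} (hK : K < 1)
    (hL : LipschitzOnWith K φ (closure Ω)) {x : Plane} (hx : x ∈ Ω) {t : ℝ} (ht : t ∈ Icc 0 1) :
    x + t • φ x ∉ frontier Ω := by
  intro hf
  have hLt : LipschitzOnWith K (t • φ) (closure Ω) := by
    refine LipschitzOnWith.of_dist_le_mul fun y hy z hz => ?_
    have := hL.dist_le_mul y hy z hz
    rw [Pi.smul_apply, Pi.smul_apply, dist_smul₀, Real.norm_of_nonneg ht.1]
    exact (mul_le_of_le_one_left dist_nonneg ht.2).trans this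
  obtain ⟨-, z, hz, hzx⟩ :=
    (hφ.const_smul hΩ.isOpen t).frontier_mem_and_surj hΩ hK hLt hf
  have := injOn_add_of_lipschitzOnWith hK hLt hz.1 (subset_closure hx) hzx
  rw [this] at hz
  exact hz.2 (by rwa [hΩ.isOpen.interior_eq])

theorem MemU0.add_mem_connectedComponentIn {Ω : Set Plane} (hΩ : IsPolygonalDomain Ω)
    {φ : Plane → Plane} (hφ : MemU0 Ω φ) {K : ℝ≥0} (hK : K < 1)
    (hL : LipschitzOnWith K φ (closure Ω)) {x : Plane} (hx : x ∈ Ω) :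
    x + φ x ∈ connectedComponentIn Ω x := by
  have hpre : IsPreconnected ((fun t : ℝ => x + t • φ x) '' Icc 0 1) :=
    isPreconnected_Icc.image _ (by fun_prop)
  have hx0 : x ∈ (fun t : ℝ => x + t • φ x) '' Icc 0 1 := ⟨0, by simp, by simp⟩
  have hsub : (fun t : ℝ => x + t • φ x) '' Icc 0 1 ⊆ Ω := by
    refine (preconnected_subset_or hΩ.isOpen hpre ?_).resolve_right fun h => h x hx0 hx
    rintro _ ⟨t, ht, rfl⟩
    exact hφ.segment_notMem_frontier hΩ hK hL hx ht
  exact hpre.subset_connectedComponentIn hx0 hsub ⟨1, by simp, by simp⟩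

/-- The identity plus a tangential field with small Lipschitz constant is a bijection of `Ω`. -/
theorem MemU0.bijOn {Ω : Set Plane} (hΩ : IsPolygonalDomain Ω)
    {φ : Plane → Plane} (hφ : MemU0 Ω φ) {K : ℝ≥0} (hK : K < 1)
    (hL : LipschitzOnWith K φ (closure Ω)) : BijOn (fun x => x + φ x) Ω Ω := by
  have hmaps := fun x (hx : x ∈ Ω) => hφ.add_mem_connectedComponentIn hΩ hK hL hx
  refine ⟨fun x hx => connectedComponentIn_subset _ _ (hmaps x hx),
    (injOn_add_of_lipschitzOnWith hK hL).mono subset_closure, fun y hy => ?_⟩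
  set U := connectedComponentIn Ω y with hU
  have hUΩ : U ⊆ Ω := connectedComponentIn_subset _ _
  have hUo : IsOpen U := hΩ.isOpen.connectedComponentIn
  have hyU : y ∈ U := mem_connectedComponentIn hy
  have hmapsU : ∀ x ∈ U, x + φ x ∈ U := fun x hx => by
    have := hmaps x (hUΩ hx)
    rwa [← connectedComponentIn_eq hx] at this
  -- The image of the component is open, meets `U`, and is relatively closed in `U`; connectedness
  -- makes it cover `U`.
  have key : U ⊆ (fun x => x + φ x) '' U := by
    refine isPreconnected_connectedComponentIn.subset_of_closure_inter_subset
      (isOpen_image_add hUo hK (hL.mono (hUΩ.trans subset_closure)))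
      ⟨y + φ y, hmapsU y hyU, y, hyU, rfl⟩ ?_
    rintro z ⟨hz, hzU⟩
    have hcU : closure U ⊆ closure Ω := closure_mono hUΩ
    have hcomp : IsCompact ((fun x => x + φ x) '' closure U) :=
      (hΩ.isCompact_closure.of_isClosed_subset isClosed_closure hcU).image_of_continuousOn
        (continuousOn_id.add (hφ.1.2.1.mono hcU))
    obtain ⟨x, hx, hxz⟩ := closure_minimal (image_mono subset_closure) hcomp.isClosed hz
    have hxz : x + φ x = z := hxz
    -- A preimage on the frontier would have its image on the frontier, but `z` lies in the open set
    -- `Ω`.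
    have hxΩ : x ∈ Ω := by
      by_contra hcon
      have := (hφ.frontier_mem_and_surj hΩ hK hL
        ⟨hcU hx, fun h => hcon (interior_subset h)⟩).1
      rw [hxz] at this
      exact this.2 (by rw [hΩ.isOpen.interior_eq]; exact hUΩ hzU)
    obtain ⟨w, hwx, hwU⟩ := mem_closure_iff.1 hx _ hΩ.isOpen.connectedComponentIn
      (mem_connectedComponentIn hxΩ)
    have : x ∈ U := by
      rw [hU, connectedComponentIn_eq hwU, ← connectedComponentIn_eq hwx]
      exact mem_connectedComponentIn hxΩ
    exact ⟨x, this, hxz⟩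
  obtain ⟨x, hx, hxy⟩ := key hyU
  exact ⟨x, hUΩ hx, hxy⟩

/-! ### Affine tangential fields vanish -/

/-- Tangential fields vanish at the points of the closure of a component which are farthest from
a given centre. -/
theorem MemU0.eq_zero_of_farthest {Ω : Set Plane} (hΩ : IsPolygonalDomain Ω) {φ : Plane → Plane}
    (hφ : MemU0 Ω φ) {p q c : Plane} (hq : q ∈ closure (connectedComponentIn Ω p))
    (hfar : ∀ x ∈ closure (connectedComponentIn Ω p), ‖x - c‖ ≤ ‖q - c‖) : φ q = 0 := by
  set U := connectedComponentIn Ω p with hU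
  have hUΩ : U ⊆ Ω := connectedComponentIn_subset _ _
  have hno : ∀ v : Plane, v ≠ 0 → q + v ∈ closure U → q - v ∈ closure U → False := by
    intro v hv h1 h2
    have e1 := hfar _ h1
    have e2 := hfar _ h2
    have e3 := parallelogram_law_with_norm ℝ (q - c) v
    rw [show q + v - c = q - c + v by abel] at e1
    rw [show q - v - c = q - c - v by abel] at e2
    have hv0 := norm_pos_iff.2 hv
    nlinarith [norm_nonneg (q - c + v), norm_nonneg (q - c - v), norm_nonneg (q - c)]
  have hqΩ : q ∉ Ω := by
    intro hqΩ
    have hUq : connectedComponentIn Ω q = U := by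
      obtain ⟨w, hwq, hwU⟩ := mem_closure_iff.1 hq _ hΩ.isOpen.connectedComponentIn
        (mem_connectedComponentIn hqΩ)
      rw [hU, connectedComponentIn_eq hwU, ← connectedComponentIn_eq hwq]
    have hnhds : U ∈ 𝓝 q := by
      rw [← hUq]
      exact hΩ.isOpen.connectedComponentIn.mem_nhds (mem_connectedComponentIn hqΩ)
    set e : Plane := EuclideanSpace.single 0 1 with he
    have he0 : e ≠ 0 := by
      intro h
      have : e 0 = 0 := by rw [h]; simp
      simp [he] at this
    obtain ⟨t, ⟨h1, h2⟩, ht⟩ := (((eventually_add_smul_mem q e hnhds).and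
      (eventually_add_smul_mem q (-e) hnhds)).and self_mem_nhdsWithin).exists
    have ht : 0 < t := ht
    refine hno (t • e) (smul_ne_zero ht.ne' he0) (subset_closure h1) (subset_closure ?_)
    rwa [smul_neg, ← sub_eq_add_neg] at h2
  have hqf : q ∈ frontier Ω := ⟨closure_mono hUΩ hq, fun h => hqΩ (interior_subset h)⟩
  rcases hΩ.isModelAt q hqf with ⟨n, hn, r, hr, hb⟩ | hc
  swap
  · exact hφ.eq_zero_of_corner hqf.1 hc
  exfalso
  set A : Set Plane := Metric.ball q r ∩ {y | inner ℝ (y - q) n < 0} with hA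
  have hAΩ : A ⊆ Ω := fun y hy => (hb y hy.1).2 hy.2
  have hAU : A ⊆ U := by
    obtain ⟨w, hwq, hwU⟩ := mem_closure_iff.1 hq _ Metric.isOpen_ball (Metric.mem_ball_self hr)
    have hwA : w ∈ A := ⟨hwq, (hb w hwq).1 (hUΩ hwU)⟩
    have := ((convex_ball q r).inter (convex_inner_lt q n)).isPreconnected
      |>.subset_connectedComponentIn hwA hAΩ
    rwa [hU, connectedComponentIn_eq hwU]
  -- At a regular frontier point a short tangent segment, centred at `q`, lies in the closure of the
  -- component; this is excluded by `hno`.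
  have hcl : ∀ y ∈ Metric.ball q r, inner ℝ (y - q) n = 0 → y ∈ closure U := by
    intro y hy hy0
    refine closure_mono hAU (mem_closure_iff_nhds.2 fun t ht => ?_)
    obtain ⟨δ, h1, h2⟩ := ((eventually_add_smul_mem y (-n)
      (inter_mem ht (Metric.isOpen_ball.mem_nhds hy))).and self_mem_nhdsWithin).exists
    have h2 : 0 < δ := h2
    refine ⟨_, h1.1, h1.2, ?_⟩
    rw [mem_ofPred_eq, add_sub_right_comm, inner_add_left, hy0, inner_smul_left, inner_neg_left,
      real_inner_self_eq_norm_sq, hn]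
    simpa using h2
  have hτn : inner ℝ (rot n) n = 0 := by
    rw [real_inner_comm, inner_rot]; simp [cross, mul_comm]
  obtain ⟨t, ⟨h1, h2⟩, ht⟩ := (((eventually_add_smul_mem q (rot n) (Metric.ball_mem_nhds q hr)).and
    (eventually_add_smul_mem q (-rot n) (Metric.ball_mem_nhds q hr))).and
    self_mem_nhdsWithin).exists
  have ht : 0 < t := ht
  rw [smul_neg, ← sub_eq_add_neg] at h2
  refine hno (t • rot n) (smul_ne_zero ht.ne' ?_) (hcl _ h1 ?_) (hcl _ h2 ?_)
  · rw [← norm_pos_iff, norm_rot, hn]; exact one_pos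
  · rw [add_sub_cancel_left, inner_smul_left, hτn, mul_zero]
  · rw [sub_sub_cancel_left, inner_neg_left, inner_smul_left, hτn, mul_zero, neg_zero]

/-- Take the point `q` farthest from `-R α`. The field vanishes at `q`, so the affine function does
too. Expanding the two squared distances bounds `2 R` times the value at `u` by a constant
independent of `R`, which excludes a positive value. -/
theorem MemU0.affine_nonpos {Ω : Set Plane} (hΩ : IsPolygonalDomain Ω) {φ : Plane → Plane}
    (hφ : MemU0 Ω φ) {p e α : Plane} {β : ℝ}
    (h : ∀ x ∈ connectedComponentIn Ω p, inner ℝ (φ x) e = inner ℝ x α + β)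
    {u : Plane} (hu : u ∈ connectedComponentIn Ω p) : inner ℝ (φ u) e ≤ 0 := by
  set U := connectedComponentIn Ω p with hU
  have hcU : closure U ⊆ closure Ω := closure_mono (connectedComponentIn_subset _ _)
  have hcl : ∀ x ∈ closure U, inner ℝ (φ x) e = inner ℝ x α + β := by
    intro x hx
    have hc : ContinuousOn (fun x => (inner ℝ (φ x) e : ℝ)) (closure U) :=
      (hφ.1.2.1.mono hcU).inner continuousOn_const
    exact (EqOn.of_subset_closure (f := fun x => (inner ℝ (φ x) e : ℝ))
      (g := fun x => inner ℝ x α + β) h hc (by fun_prop) subset_closure subset_rfl) hx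
  have hcomp : IsCompact (closure U) :=
    hΩ.isCompact_closure.of_isClosed_subset isClosed_closure hcU
  obtain ⟨B, hB⟩ := hcomp.isBounded.exists_norm_le
  have key : ∀ R : ℝ, 2 * R * inner ℝ (φ u) e ≤ B ^ 2 := by
    intro R
    obtain ⟨q, hq, hmax⟩ := hcomp.exists_isMaxOn ⟨u, subset_closure hu⟩
      (f := fun x => ‖x - (-R) • α‖) (by fun_prop)
    have hφq : φ q = 0 := hφ.eq_zero_of_farthest hΩ hq (c := (-R) • α) fun x hx => hmax hx
    have h1 : ‖u - (-R) • α‖ ≤ ‖q - (-R) • α‖ := hmax (subset_closure hu)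
    have h2 : ‖u - (-R) • α‖ ^ 2 ≤ ‖q - (-R) • α‖ ^ 2 := by gcongr
    have h3 : ‖q‖ ^ 2 ≤ B ^ 2 := by
      have := hB q hq
      gcongr
    have h4 := hcl q hq
    rw [hφq, inner_zero_left] at h4
    rw [hcl u (subset_closure hu)]
    rw [norm_sub_sq_real, norm_sub_sq_real, inner_smul_right, inner_smul_right] at h2
    rw [show inner ℝ q α = -β by linarith] at h2
    linarith [sq_nonneg ‖u‖]
  by_contra hcon
  push Not at hcon
  have := key ((B ^ 2 + 1) / (2 * inner ℝ (φ u) e))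
  rw [show 2 * ((B ^ 2 + 1) / (2 * inner ℝ (φ u) e)) * inner ℝ (φ u) e = B ^ 2 + 1 by
    field_simp] at this
  linarith

theorem MemU0.eq_zero_of_affine {Ω : Set Plane} (hΩ : IsPolygonalDomain Ω) {φ : Plane → Plane}
    (hφ : MemU0 Ω φ) {p : Plane}
    (h : ∀ k : Fin 2, ∃ (α : Plane) (β : ℝ), ∀ x ∈ connectedComponentIn Ω p,
      φ x k = inner ℝ x α + β)
    {u : Plane} (hu : u ∈ connectedComponentIn Ω p) : φ u = 0 := by
  ext k
  obtain ⟨α, β, hαβ⟩ := h k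
  set e : Plane := EuclideanSpace.single k 1 with he
  have hin : ∀ y : Plane, inner ℝ y e = y k := fun y => by
    simp [he, EuclideanSpace.inner_single_right]
  have h1 := hφ.affine_nonpos hΩ (e := e) (fun x hx => (hin _).trans (hαβ x hx)) hu
  have h2 := hφ.affine_nonpos hΩ (e := -e) (α := -α) (β := -β) (fun x hx => by
    rw [inner_neg_right, inner_neg_right, hin, hαβ x hx]; ring) hu
  rw [inner_neg_right] at h2
  rw [hin] at h1 h2
  simp only [PiLp.zero_apply]
  linarith

/-! ### Weak derivatives -/

/-- The test functions on `Ω`. -/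
def IsTest (Ω : Set Plane) (η : Plane → ℝ) : Prop :=
  ContDiff ℝ ∞ η ∧ HasCompactSupport η ∧ tsupport η ⊆ Ω

theorem IsTest.partialDeriv {Ω : Set Plane} {η : Plane → ℝ} (h : IsTest Ω η) (i : Fin 2) :
    IsTest Ω (partialDeriv i η) := by
  have hs : tsupport (Registration.partialDeriv i η) ⊆ tsupport η :=
    tsupport_fderiv_apply_subset ℝ _
  refine ⟨?_, h.2.1.of_isClosed_subset (isClosed_tsupport _) hs, hs.trans h.2.2⟩
  exact (h.1.fderiv_right (m := ∞) (by simp)).clm_apply contDiff_const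

theorem IsTest.iterPartial {Ω : Set Plane} {η : Plane → ℝ} (h : IsTest Ω η) (α : List (Fin 2)) :
    IsTest Ω (iterPartial α η) := by
  induction α with
  | nil => exact h
  | cons i α ih => exact ih.partialDeriv i

theorem IsTest.integrable_mul {Ω : Set Plane} {u η : Plane → ℝ} (hu : LocallyIntegrableOn u Ω)
    (h : IsTest Ω η) : Integrable (fun x => u x * η x) := by
  have h1 : IntegrableOn u (tsupport η) := hu.integrableOn_compact_subset h.2.2 h.2.1
  have h2 : IntegrableOn (fun x => u x * η x) (tsupport η) :=
    h1.mul_continuousOn h.1.continuous.continuousOn h.2.1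
  refine (integrableOn_iff_integrable_of_support_subset ?_).1 h2
  intro x hx
  by_contra hcon
  exact hx (by simp [image_eq_zero_of_notMem_tsupport hcon])

theorem IsTest.setIntegral_mul {Ω : Set Plane} {η : Plane → ℝ} (h : IsTest Ω η)
    (u : Plane → ℝ) : ∫ x in Ω, u x * η x = ∫ x, u x * η x := by
  apply setIntegral_eq_integral_of_forall_compl_eq_zero
  intro x hx
  rw [image_eq_zero_of_notMem_tsupport fun hx' => hx (h.2.2 hx'), mul_zero]

theorem IsTest.integral_mul_partialDeriv {Ω : Set Plane} (hΩ : IsOpen Ω) {h η : Plane → ℝ}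
    (hh : ContDiffOn ℝ 1 h Ω) (hη : IsTest Ω η) (i : Fin 2) :
    ∫ x in Ω, h x * Registration.partialDeriv i η x =
      -∫ x in Ω, Registration.partialDeriv i h x * η x := by
  have hd : ContinuousOn (Registration.partialDeriv i h) Ω :=
    (hh.continuousOn_fderiv_of_isOpen hΩ le_rfl).clm_apply continuousOn_const
  rw [(hη.partialDeriv i).setIntegral_mul, hη.setIntegral_mul]
  apply integral_mul_fderiv_eq_neg_fderiv_mul_of_integrable
  · exact hη.integrable_mul (hd.locallyIntegrableOn hΩ.measurableSet)
  · exact (hη.partialDeriv i).integrable_mul (hh.continuousOn.locallyIntegrableOn hΩ.measurableSet)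
  · exact hη.integrable_mul (hh.continuousOn.locallyIntegrableOn hΩ.measurableSet)
  · exact fun x hx => (hh.differentiableOn one_ne_zero).differentiableAt (hΩ.mem_nhds (hη.2.2 hx))
  · exact fun x _ => hη.1.differentiable (by simp) x

/-- The fundamental lemma of the calculus of variations. It makes the representative chosen in
`weakPartial` immaterial. -/
theorem IsWeakPartial.ae_eq {Ω : Set Plane} (hΩ : IsOpen Ω) {α : List (Fin 2)}
    {u v w : Plane → ℝ} (hv : IsWeakPartial Ω α u v) (hw : IsWeakPartial Ω α u w) :
    v =ᵐ[volume.restrict Ω] w := by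
  have h := hΩ.ae_eq_zero_of_integral_contDiff_smul_eq_zero (μ := volume)
    (hv.2.1.sub hw.2.1) fun η h1 h2 h3 => by
      have hη : IsTest Ω η := ⟨h1, h2, h3⟩
      have e1 := hv.2.2 η h1 h2 h3
      rw [hw.2.2 η h1 h2 h3] at e1
      have e2 := mul_left_cancel₀ (pow_ne_zero _ (by norm_num)) e1
      rw [hη.setIntegral_mul, hη.setIntegral_mul] at e2
      have e3 : (fun x => η x • (v - w) x) = fun x => v x * η x - w x * η x := by
        ext x; simp only [smul_eq_mul, Pi.sub_apply]; ring
      rw [e3, integral_sub (hη.integrable_mul hv.2.1) (hη.integrable_mul hw.2.1), e2, sub_self]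
  rw [Filter.EventuallyEq, ae_restrict_iff' hΩ.measurableSet]
  filter_upwards [h] with x hx hxΩ
  exact sub_eq_zero.1 (hx hxΩ)

theorem IsWeakPartial.weakPartial_ae_eq {Ω : Set Plane} (hΩ : IsOpen Ω) {α : List (Fin 2)}
    {u v : Plane → ℝ} (hv : IsWeakPartial Ω α u v) :
    weakPartial Ω α u =ᵐ[volume.restrict Ω] v := by
  have hex : ∃ v, IsWeakPartial Ω α u v := ⟨v, hv⟩
  rw [weakPartial, dif_pos hex]
  exact hex.choose_spec.ae_eq hΩ hv

theorem IsWeakPartial.add {Ω : Set Plane} {α : List (Fin 2)} {u v u' v' : Plane → ℝ}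
    (h : IsWeakPartial Ω α u v) (h' : IsWeakPartial Ω α u' v') :
    IsWeakPartial Ω α (u + u') (v + v') := by
  refine ⟨h.1.add h'.1, h.2.1.add h'.2.1, fun η h1 h2 h3 => ?_⟩
  have hη : IsTest Ω η := ⟨h1, h2, h3⟩
  simp only [Pi.add_apply, add_mul]
  rw [integral_add ((hη.iterPartial α).integrable_mul h.1).integrableOn
    ((hη.iterPartial α).integrable_mul h'.1).integrableOn,
    integral_add (hη.integrable_mul h.2.1).integrableOn (hη.integrable_mul h'.2.1).integrableOn,
    h.2.2 η h1 h2 h3, h'.2.2 η h1 h2 h3]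
  ring

theorem IsWeakPartial.const_smul {Ω : Set Plane} {α : List (Fin 2)} {u v : Plane → ℝ}
    (h : IsWeakPartial Ω α u v) (c : ℝ) : IsWeakPartial Ω α (c • u) (c • v) := by
  refine ⟨h.1.smul c, h.2.1.smul c, fun η h1 h2 h3 => ?_⟩
  simp only [Pi.smul_apply, smul_eq_mul, mul_assoc]
  rw [integral_const_mul, integral_const_mul, h.2.2 η h1 h2 h3]
  ring

theorem isWeakPartial_zero (Ω : Set Plane) (α : List (Fin 2)) : IsWeakPartial Ω α 0 0 :=
  ⟨locallyIntegrableOn_zero, locallyIntegrableOn_zero, fun η _ _ _ => by simp⟩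

theorem IsWeakPartial.sum {Ω : Set Plane} {α : List (Fin 2)} {M : ℕ} {u v : Fin M → Plane → ℝ}
    (h : ∀ i, IsWeakPartial Ω α (u i) (v i)) (a : Fin M → ℝ) :
    IsWeakPartial Ω α (∑ i, a i • u i) (∑ i, a i • v i) := by
  have key : ∀ s : Finset (Fin M),
      IsWeakPartial Ω α (∑ i ∈ s, a i • u i) (∑ i ∈ s, a i • v i) := by
    intro s
    induction s using Finset.induction_on with
    | empty => simpa using isWeakPartial_zero Ω α
    | insert i s his ih =>
      rw [Finset.sum_insert his, Finset.sum_insert his]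
      exact ((h i).const_smul (a i)).add ih
  exact key Finset.univ

theorem IsTest.integral_partialDeriv {Ω : Set Plane} (hΩ : IsOpen Ω) {η : Plane → ℝ}
    (hη : IsTest Ω η) (i : Fin 2) : ∫ x in Ω, Registration.partialDeriv i η x = 0 := by
  have := hη.integral_mul_partialDeriv hΩ (h := fun _ => 1) contDiffOn_const i
  simpa [Registration.partialDeriv] using this

/-- The coordinate functions have vanishing weak second derivatives. -/
theorem isWeakPartial_coord {Ω : Set Plane} (hΩ : IsOpen Ω) (k i j : Fin 2) :
    IsWeakPartial Ω [i, j] (fun x : Plane => x k) 0 := by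
  have hsm : ContDiff ℝ 1 (fun x : Plane => x k) := by fun_prop
  refine ⟨hsm.continuous.locallyIntegrable.locallyIntegrableOn Ω, locallyIntegrableOn_zero,
    fun η h1 h2 h3 => ?_⟩
  have hη : IsTest Ω η := ⟨h1, h2, h3⟩
  have e := (hη.partialDeriv j).integral_mul_partialDeriv hΩ hsm.contDiffOn i
  have hd : ∀ x, partialDeriv i (fun x : Plane => x k) x =
      (EuclideanSpace.single i (1 : ℝ) : Plane) k := by
    intro x
    have : HasFDerivAt (fun x : Plane => x k) (EuclideanSpace.proj k : Plane →L[ℝ] ℝ) x :=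
      (EuclideanSpace.proj k : Plane →L[ℝ] ℝ).hasFDerivAt
    rw [partialDeriv, this.fderiv]; rfl
  simp only [hd] at e
  rw [integral_const_mul, hη.integral_partialDeriv hΩ, mul_zero, neg_zero] at e
  simpa [iterPartial] using e

/-! ### Functions with vanishing weak derivatives -/

theorem clm_eq_zero_of_single {L : Plane →L[ℝ] ℝ}
    (h : ∀ i : Fin 2, L (EuclideanSpace.single i 1) = 0) : L = 0 := by
  ext w
  have : w = w 0 • EuclideanSpace.single 0 (1 : ℝ) + w 1 • EuclideanSpace.single 1 (1 : ℝ) := by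
    apply plane_ext <;> simp
  rw [this, map_add, map_smul, map_smul, h, h]
  simp

/-- A continuous function whose weak gradient vanishes is locally constant. -/
theorem eventually_eq_of_weak_gradient_zero {Ω : Set Plane} (hΩ : IsOpen Ω) {g : Plane → ℝ}
    (hg : ContinuousOn g Ω)
    (h : ∀ (j : Fin 2) (η : Plane → ℝ), IsTest Ω η → ∫ x in Ω, g x * partialDeriv j η x = 0)
    {x : Plane} (hx : x ∈ Ω) : ∀ᶠ y in 𝓝 x, g y = g x := by
  obtain ⟨ρ, hρ, hball⟩ := Metric.isOpen_iff.1 hΩ x hx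
  -- Mollifiers of radius below `r`, centred in the ball of radius `r`, have support in the ball of
  -- radius `2 * r`, which is still inside `Ω`. Cutting `g` off outside it changes nothing there and
  -- makes convolution available on the whole plane.
  set r := ρ / 3 with hr
  have hr0 : 0 < r := by positivity
  set B := Metric.closedBall x (2 * r) with hB
  have hBΩ : B ⊆ Ω := (Metric.closedBall_subset_ball (by rw [hr]; linarith)).trans hball
  have hBc : IsCompact B := isCompact_closedBall x (2 * r)
  set G : Plane → ℝ := B.indicator g with hG
  have hGint : Integrable G :=
    ((hg.mono hBΩ).integrableOn_compact hBc).integrable_indicator hBc.measurableSet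
  let b : ℕ → ContDiffBump (0 : Plane) := fun n =>
    ⟨r / 2 / (n + 2), r / 2 / (n + 1), by positivity, by
      apply div_lt_div_of_pos_left <;> first | positivity | linarith⟩
  have hbr : ∀ n, (b n).rOut < r := fun n => by
    change r / 2 / (n + 1) < r
    rw [div_lt_iff₀ (by positivity)]
    nlinarith [(Nat.cast_nonneg n : (0 : ℝ) ≤ n)]
  have hb0 : Tendsto (fun n => (b n).rOut) atTop (𝓝 0) := by
    have := tendsto_one_div_add_atTop_nhds_zero_nat (𝕜 := ℝ)
    have := this.const_mul (r / 2)
    simpa [b, div_eq_mul_inv] using this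
  let L := (ContinuousLinearMap.lsmul ℝ ℝ : ℝ →L[ℝ] ℝ →L[ℝ] ℝ)
  let F : ℕ → Plane → ℝ := fun n =>
    MeasureTheory.convolution G ((b n).normed volume) L.flip volume
  have hFd : ∀ n y, HasFDerivAt (F n) (MeasureTheory.convolution G
      (fderiv ℝ ((b n).normed volume)) (L.flip.precompR Plane) volume y) y := fun n y =>
    (b n).hasCompactSupport_normed.hasFDerivAt_convolution_right L.flip hGint.locallyIntegrable
      (b n).contDiff_normed y
  have hF0 : ∀ n, ∀ y ∈ Metric.ball x r, fderiv ℝ (F n) y = 0 := by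
    intro n y hy
    rw [(hFd n y).fderiv]
    refine clm_eq_zero_of_single fun j => ?_
    have hsm : ContDiff ℝ ∞ ((b n).normed volume : Plane → ℝ) := (b n).contDiff_normed
    rw [MeasureTheory.convolution_precompR_apply _ hGint.locallyIntegrable
      ((b n).hasCompactSupport_normed.fderiv ℝ) (hsm.continuous_fderiv (by simp))]
    -- The derivative of the mollification at `y` is, up to sign, the weak gradient of `g` tested
    -- against this translated and reflected bump.
    set η : Plane → ℝ := fun t => (b n).normed volume (y - t) with hη
    have hsupp : ∀ t, η t ≠ 0 → t ∈ Metric.closedBall y (b n).rOut := by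
      intro t ht
      have h1 : y - t ∈ Function.support ((b n).normed volume : Plane → ℝ) := ht
      rw [(b n).support_normed_eq] at h1
      rw [Metric.mem_closedBall, dist_comm, dist_eq_norm]
      exact (mem_ball_zero_iff.1 h1).le
    have htB : tsupport η ⊆ B := by
      refine (closure_minimal (fun t ht => hsupp t ht) Metric.isClosed_closedBall).trans ?_
      refine Metric.closedBall_subset_closedBall' ?_
      have := hbr n
      have := Metric.mem_ball.1 hy
      linarith
    have hηt : IsTest Ω η := by
      refine ⟨hsm.comp (by fun_prop), hBc.of_isClosed_subset (isClosed_tsupport _) htB,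
        htB.trans hBΩ⟩
    have hηd : ∀ t, partialDeriv j η t =
        -fderiv ℝ ((b n).normed volume) (y - t) (EuclideanSpace.single j 1) := by
      intro t
      have h1 : HasFDerivAt (fun t : Plane => y - t) (-ContinuousLinearMap.id ℝ Plane) t :=
        (hasFDerivAt_id t).const_sub y
      have h2 := (hsm.differentiable (by simp) (y - t)).hasFDerivAt.comp t h1
      have h3 : fderiv ℝ η t = _ := h2.fderiv
      rw [partialDeriv, h3]
      simp
    have h0 := h j η hηt
    rw [(hηt.partialDeriv j).setIntegral_mul] at h0
    rw [MeasureTheory.convolution_def]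
    have e : (fun t => L.flip (G t) (fderiv ℝ ((b n).normed volume) (y - t)
        (EuclideanSpace.single j 1))) = fun t => -(g t * partialDeriv j η t) := by
      ext t
      change fderiv ℝ ((b n).normed volume) (y - t) (EuclideanSpace.single j 1) * G t = _
      by_cases ht : t ∈ B
      · rw [hηd, hG, indicator_of_mem ht]; ring
      · have h4 : partialDeriv j η t = 0 := by
          rw [partialDeriv, fderiv_of_notMem_tsupport (𝕜 := ℝ) fun h => ht (htB h)]; rfl
        rw [h4, hG, indicator_of_notMem ht]; simp
    rw [e, integral_neg, h0, neg_zero]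
  have hFc : ∀ n, ∀ y ∈ Metric.ball x r, F n y = F n x := fun n y hy =>
    Metric.isOpen_ball.is_const_of_fderiv_eq_zero (𝕜 := ℝ) (convex_ball x r).isPreconnected
      (fun z _ => (hFd n z).differentiableAt.differentiableWithinAt) (fun z hz => hF0 n z hz) hy
      (Metric.mem_ball_self hr0)
  have hlim : ∀ y ∈ Metric.ball x r, Tendsto (fun n => F n y) atTop (𝓝 (g y)) := by
    intro y hy
    have hyB : B ∈ 𝓝 y := by
      refine mem_of_superset (Metric.isOpen_ball.mem_nhds hy) ?_
      exact Metric.ball_subset_closedBall.trans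
        (Metric.closedBall_subset_closedBall (by linarith))
    have hGy : Tendsto G (𝓝 y) (𝓝 (g y)) := by
      have hgy : ContinuousAt g y := hg.continuousAt (hΩ.mem_nhds (hBΩ (mem_of_mem_nhds hyB)))
      refine hgy.tendsto.congr' ?_
      filter_upwards [hyB] with z hz
      rw [hG, indicator_of_mem hz]
    have := ContDiffBump.convolution_tendsto_right (μ := volume) (φ := b) (g := fun _ => G)
      (k := fun _ => y) (x₀ := y) (z₀ := g y) hb0
      (Eventually.of_forall fun _ => hGint.aestronglyMeasurable)
      (hGy.comp tendsto_snd) tendsto_const_nhds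
    refine this.congr fun n => ?_
    exact congrFun (MeasureTheory.convolution_flip (L := L) (μ := volume)
      (f := (b n).normed volume) (g := G)).symm y
  filter_upwards [Metric.ball_mem_nhds x hr0] with y hy
  exact tendsto_nhds_unique ((hlim y hy).congr fun n => hFc n y hy)
    (hlim x (Metric.mem_ball_self hr0))

/-- One integration by parts turns the vanishing weak Hessian into a vanishing weak gradient of the
continuous classical derivative, which is then locally constant. -/
theorem partialDeriv_eq_of_preconnected {Ω : Set Plane} (hΩ : IsOpen Ω) {h : Plane → ℝ}
    (hh : ContDiffOn ℝ 1 h Ω) (hw : ∀ i j, IsWeakPartial Ω [i, j] h 0) {U : Set Plane}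
    (hUo : IsOpen U) (hU : IsPreconnected U) (hUΩ : U ⊆ Ω) (i : Fin 2) {x y : Plane}
    (hx : x ∈ U) (hy : y ∈ U) : partialDeriv i h x = partialDeriv i h y := by
  have hd : ContinuousOn (partialDeriv i h) Ω :=
    (hh.continuousOn_fderiv_of_isOpen hΩ le_rfl).clm_apply continuousOn_const
  have hloc : ∀ z ∈ Ω, ∀ᶠ w in 𝓝 z, partialDeriv i h w = partialDeriv i h z := fun z hz =>
    eventually_eq_of_weak_gradient_zero hΩ hd (fun j η hη => by
      have e1 := (hη.partialDeriv j).integral_mul_partialDeriv hΩ hh i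
      have e2 := (hw i j).2.2 η hη.1 hη.2.1 hη.2.2
      have e3 : iterPartial [i, j] η = partialDeriv i (partialDeriv j η) := rfl
      rw [e3, e1] at e2
      simpa using e2) hz
  have hfd : ∀ z ∈ Ω, HasFDerivAt (partialDeriv i h) (0 : Plane →L[ℝ] ℝ) z := fun z hz =>
    (hasFDerivAt_const (partialDeriv i h z) z).congr_of_eventuallyEq (hloc z hz)
  exact hUo.is_const_of_fderiv_eq_zero (𝕜 := ℝ) hU
    (fun z hz => (hfd z (hUΩ hz)).differentiableAt.differentiableWithinAt)
    (fun z hz => (hfd z (hUΩ hz)).fderiv) hx hy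

/-- A function of class `C¹` with vanishing weak second derivatives is affine on connected sets. -/
theorem exists_affine_of_weak_hessian_zero {Ω : Set Plane} (hΩ : IsOpen Ω) {h : Plane → ℝ}
    (hh : ContDiffOn ℝ 1 h Ω) (hw : ∀ i j, IsWeakPartial Ω [i, j] h 0) {U : Set Plane}
    (hUo : IsOpen U) (hU : IsPreconnected U) (hUΩ : U ⊆ Ω) :
    ∃ (α : Plane) (β : ℝ), ∀ x ∈ U, h x = inner ℝ x α + β := by
  rcases U.eq_empty_or_nonempty with rfl | ⟨p, hp⟩
  · exact ⟨0, 0, by simp⟩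
  set α : Plane := !₂[partialDeriv 0 h p, partialDeriv 1 h p] with hα
  have hdiff : ∀ x ∈ U, DifferentiableAt ℝ h x := fun x hx =>
    (hh.differentiableOn one_ne_zero).differentiableAt (hΩ.mem_nhds (hUΩ hx))
  have hin : ∀ x, HasFDerivAt (fun x : Plane => (inner ℝ x α : ℝ)) (innerSL ℝ α) x := fun x => by
    have := (innerSL ℝ α).hasFDerivAt (x := x)
    refine this.congr_of_eventuallyEq (Eventually.of_forall fun y => ?_)
    simp only [innerSL_apply_apply]
    exact real_inner_comm _ _
  obtain ⟨β, hβ⟩ := hUo.exists_eq_add_of_fderiv_eq (𝕜 := ℝ) hU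
    (fun x hx => (hdiff x hx).differentiableWithinAt)
    (fun x _ => (hin x).differentiableAt.differentiableWithinAt) (fun x hx => by
      rw [← sub_eq_zero]
      refine clm_eq_zero_of_single fun i => ?_
      rw [(hin x).fderiv, sub_apply, sub_eq_zero]
      change partialDeriv i h x = _
      rw [partialDeriv_eq_of_preconnected hΩ hh hw hUo hU hUΩ i hx hp, innerSL_apply_apply,
        EuclideanSpace.inner_single_right]
      fin_cases i <;> simp [hα])
  exact ⟨α, β, hβ⟩

theorem MemU0.eq_zero_of_weak_hessian {Ω : Set Plane} (hΩ : IsPolygonalDomain Ω)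
    {φ : Plane → Plane} (hφ : MemU0 Ω φ)
    (hw : ∀ k i j : Fin 2, IsWeakPartial Ω [i, j] (fun x => φ x k) 0)
    {u : Plane} (hu : u ∈ closure Ω) :
    φ u = 0 := by
  have h : ∀ u ∈ Ω, φ u = 0 := fun u hu => by
    refine hφ.eq_zero_of_affine hΩ (p := u) (fun k => ?_) (mem_connectedComponentIn hu)
    refine exists_affine_of_weak_hessian_zero hΩ.isOpen ?_ (hw k) hΩ.isOpen.connectedComponentIn
      isPreconnected_connectedComponentIn (connectedComponentIn_subset _ _)
    exact (contDiffOn_piLp (p := 2)).1 hφ.1.1 k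
  exact EqOn.of_subset_closure (g := fun _ => 0) h hφ.1.2.1 continuousOn_const subset_closure
    subset_rfl hu

/-! ### The Hessian seminorm -/

theorem affineMapOp_eq {M : ℕ} (φ : Fin M → Plane → Plane) (a : EuclideanSpace ℝ (Fin M)) :
    affineMapOp φ a = fun x => x + (∑ i, a i • φ i) x := by
  ext1 x
  simp [affineMapOp, Finset.sum_apply]

theorem IsWeakPartial.congr_ae_zero {Ω : Set Plane} {α : List (Fin 2)} {u v : Plane → ℝ}
    (h : IsWeakPartial Ω α u v) (hv : v =ᵐ[volume.restrict Ω] 0) : IsWeakPartial Ω α u 0 := by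
  refine ⟨h.1, locallyIntegrableOn_zero, fun η h1 h2 h3 => ?_⟩
  rw [h.2.2 η h1 h2 h3]
  congr 1
  refine integral_congr_ae ?_
  filter_upwards [hv] with x hx
  rw [hx]

/-- The space of arrays of second derivatives, with the Frobenius norm. -/
abbrev HessianArray : Type := EuclideanSpace ℝ (Fin 2 × Fin 2 × Fin 2)

/-- The Hessian of the identity drops out, leaving a linear function of the coefficients with values
in `Lp`. Its kernel consists of coefficients whose combined field is affine on each component, hence
zero on `closure Ω`, and linear independence applies there. -/
theorem exists_hessian_linearMap {Ω : Set Plane} (hΩ : IsPolygonalDomain Ω) {M : ℕ}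
    {φ : Fin M → Plane → Plane} (hU0 : ∀ i, MemU0 Ω (φ i)) (hW : ∀ i, MemW2Infty Ω (φ i))
    (hlin : LinearIndependent ℝ (fun i => (closure Ω).domRestrict (φ i))) :
    ∃ T : EuclideanSpace ℝ (Fin M) →ₗ[ℝ] Lp HessianArray ∞ (volume.restrict Ω),
      LinearMap.ker T = ⊥ ∧ ∀ a,
        (eLpNorm (hessianNorm Ω (affineMapOp φ a)) ∞ (volume.restrict Ω)).toReal = ‖T a‖ := by
  have hex : ∀ (m : Fin M) (k i j : Fin 2), ∃ v : Plane → ℝ, MemLp v ∞ (volume.restrict Ω) ∧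
      IsWeakPartial Ω [i, j] (fun x => φ m x k) v := fun m k i j => hW m k [i, j] (by simp)
  choose v hv hvw using hex
  let V : Fin M → Plane → HessianArray := fun m x =>
    WithLp.toLp 2 fun p => v m p.1 p.2.1 p.2.2 x
  have hV : ∀ m, MemLp (V m) ∞ (volume.restrict Ω) := fun m =>
    MemLp.of_eval_piLp fun p => hv m p.1 p.2.1 p.2.2
  have hS : ∀ a : EuclideanSpace ℝ (Fin M), MemLp (∑ m, a m • V m) ∞ (volume.restrict Ω) :=
    fun a => memLp_finsetSum' _ fun m _ => (hV m).const_smul (a m)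
  let T : EuclideanSpace ℝ (Fin M) →ₗ[ℝ] Lp HessianArray ∞ (volume.restrict Ω) :=
    { toFun := fun a => (hS a).toLp
      map_add' := fun a b => by
        rw [← MemLp.toLp_add]
        refine MemLp.toLp_congr _ _ (Eventually.of_forall fun x => ?_)
        simp [add_smul, Finset.sum_add_distrib]
      map_smul' := fun c a => by
        rw [RingHom.id_apply, ← MemLp.toLp_const_smul]
        refine MemLp.toLp_congr _ _ (Eventually.of_forall fun x => ?_)
        simp [mul_smul, Finset.smul_sum] }
  have hSapp : ∀ (a : EuclideanSpace ℝ (Fin M)) (x : Plane) (k i j : Fin 2),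
      (∑ m, a m • V m) x (k, i, j) = (∑ m, a m • v m k i j) x := fun a x k i j => by
    simp [V, Finset.sum_apply]
  have hweak : ∀ (a : EuclideanSpace ℝ (Fin M)) (k i j : Fin 2),
      IsWeakPartial Ω [i, j] (fun x => (∑ m, a m • φ m) x k) (∑ m, a m • v m k i j) :=
    fun a k i j => by
      have := IsWeakPartial.sum (fun m => hvw m k i j) a
      convert this using 1
      ext x; simp [Finset.sum_apply]
  refine ⟨T, ?_, fun a => ?_⟩
  · rw [LinearMap.ker_eq_bot']
    intro a ha
    have h0 : (∑ m, a m • V m) =ᵐ[volume.restrict Ω] 0 :=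
      (MemLp.toLp_eq_toLp_iff (hS a) MemLp.zero).1 (by rw [MemLp.toLp_zero]; exact ha)
    have hz : ∀ u ∈ closure Ω, (∑ m, a m • φ m) u = 0 := fun u hu =>
      (MemU0.sum hΩ.isOpen hU0 a).eq_zero_of_weak_hessian hΩ (fun k i j =>
        (hweak a k i j).congr_ae_zero (by
          filter_upwards [h0] with x hx
          rw [← hSapp, hx]; rfl)) hu
    have := Fintype.linearIndependent_iff.1 hlin a (by
      ext1 ⟨u, hu⟩
      have := hz u hu
      simpa [Finset.sum_apply] using this)
    ext i
    exact this i
  · rw [Lp.norm_def]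
    congr 1
    refine eLpNorm_congr_norm_ae ?_
    have hae : ∀ k i j : Fin 2, weakPartial Ω [i, j] (fun x => affineMapOp φ a x k)
        =ᵐ[volume.restrict Ω] (∑ m, a m • v m k i j) := fun k i j => by
      refine IsWeakPartial.weakPartial_ae_eq hΩ.isOpen ?_
      have := (isWeakPartial_coord hΩ.isOpen k i j).add (hweak a k i j)
      rw [zero_add] at this
      convert this using 1
      rw [affineMapOp_eq]
      ext x; simp
    have hae' : ∀ᵐ x ∂(volume.restrict Ω), ∀ k i j : Fin 2,
        weakPartial Ω [i, j] (fun x => affineMapOp φ a x k) x = (∑ m, a m • v m k i j) x := by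
      simp only [ae_all_iff]
      exact hae
    filter_upwards [hae', (hS a).coeFn_toLp] with x hx hx2
    change _ = ‖((hS a).toLp : Plane → HessianArray) x‖
    rw [hx2, EuclideanSpace.norm_eq, hessianNorm, Real.norm_of_nonneg (Real.sqrt_nonneg _)]
    congr 1
    rw [Fintype.sum_prod_type]
    refine Finset.sum_congr rfl fun k _ => ?_
    rw [Fintype.sum_prod_type]
    refine Finset.sum_congr rfl fun i _ => Finset.sum_congr rfl fun j _ => ?_
    rw [hx k i j, hSapp, Real.norm_eq_abs, sq_abs]

/-- An injective linear map on a finite-dimensional space is bounded below as well as above. -/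
theorem exists_hessian_bounds {Ω : Set Plane} (hΩ : IsPolygonalDomain Ω) {M : ℕ}
    {φ : Fin M → Plane → Plane} (hU0 : ∀ i, MemU0 Ω (φ i)) (hW : ∀ i, MemW2Infty Ω (φ i))
    (hlin : LinearIndependent ℝ (fun i => (closure Ω).domRestrict (φ i))) :
    ∃ p : EuclideanSpace ℝ (Fin M) → ℝ,
      (∀ a, (eLpNorm (hessianNorm Ω (affineMapOp φ a)) ∞ (volume.restrict Ω)).toReal = p a) ∧
      (∃ c > 0, ∀ a, c * ‖a‖ ≤ p a) ∧ p 0 = 0 ∧ ∃ C : ℝ≥0, LipschitzWith C p := by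
  obtain ⟨T, hker, hT⟩ := exists_hessian_linearMap hΩ hU0 hW hlin
  refine ⟨fun a => ‖T a‖, hT, ?_, by simp, ?_⟩
  · obtain ⟨K, hK, hanti⟩ := T.exists_antilipschitzWith hker
    have hK' : (0 : ℝ) < K := by exact_mod_cast hK
    refine ⟨(K : ℝ)⁻¹, inv_pos.2 hK', fun a => ?_⟩
    have := hanti.le_mul_dist a 0
    rw [map_zero, dist_zero_right, dist_zero_right] at this
    rwa [inv_mul_le_iff₀ hK']
  · let T' := LinearMap.toContinuousLinearMap T
    exact ⟨‖T'‖₊, by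
      have := lipschitzWith_one_norm.comp T'.lipschitz
      rwa [one_mul] at this⟩

/-! ### The Jacobian determinant -/

theorem det_eq (A : Plane →L[ℝ] Plane) :
    A.det = A (EuclideanSpace.single 0 1) 0 * A (EuclideanSpace.single 1 1) 1 -
      A (EuclideanSpace.single 1 1) 0 * A (EuclideanSpace.single 0 1) 1 := by
  have h := LinearMap.det_toMatrix (EuclideanSpace.basisFun (Fin 2) ℝ).toBasis
    (A : Plane →ₗ[ℝ] Plane)
  rw [ContinuousLinearMap.det, ← h, Matrix.det_fin_two]
  simp [LinearMap.toMatrix_apply]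

/-- The determinant of the identity plus a linear combination of matrices. -/
def detPoly {M : ℕ} (a : EuclideanSpace ℝ (Fin M)) (m : Fin M → Fin 2 → Fin 2 → ℝ) : ℝ :=
  (1 + ∑ i, a i * m i 0 0) * (1 + ∑ i, a i * m i 1 1) -
    (∑ i, a i * m i 0 1) * ∑ i, a i * m i 1 0

theorem contDiff_detPoly (M : ℕ) :
    ContDiff ℝ 1 (fun z : EuclideanSpace ℝ (Fin M) × (Fin M → Fin 2 → Fin 2 → ℝ) =>
      detPoly z.1 z.2) := by
  unfold detPoly
  fun_prop

theorem detPoly_zero {M : ℕ} (m : Fin M → Fin 2 → Fin 2 → ℝ) : detPoly 0 m = 1 := by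
  simp [detPoly]

/-- The Jacobian is quadratic along rays, so three values on a ray determine it. -/
theorem detPoly_smul {M : ℕ} (a : EuclideanSpace ℝ (Fin M)) (m : Fin M → Fin 2 → Fin 2 → ℝ)
    (t : ℝ) : detPoly (t • a) m = 1 + t * (∑ i, a i * m i 0 0 + ∑ i, a i * m i 1 1) +
      t ^ 2 * ((∑ i, a i * m i 0 0) * (∑ i, a i * m i 1 1) -
        (∑ i, a i * m i 0 1) * ∑ i, a i * m i 1 0) := by
  simp only [detPoly, PiLp.smul_apply, smul_eq_mul, mul_assoc, ← Finset.mul_sum]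
  ring

/-- The entries of the gradients of the fields `φ i`. -/
def gradEntries {M : ℕ} (φ : Fin M → Plane → Plane) (x : Plane) : Fin M → Fin 2 → Fin 2 → ℝ :=
  fun i k l => fderiv ℝ (φ i) x (EuclideanSpace.single l 1) k

section

variable {Ω : Set Plane} {M : ℕ} {φ : Fin M → Plane → Plane}

theorem hasFDerivAt_affineMapOp (hΩ : IsOpen Ω) (hφ : ∀ i, IsC1UpToBoundary Ω (φ i))
    (a : EuclideanSpace ℝ (Fin M)) {x : Plane} (hx : x ∈ Ω) :
    HasFDerivAt (affineMapOp φ a)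
      (ContinuousLinearMap.id ℝ Plane + ∑ i, a i • fderiv ℝ (φ i) x) x :=
  (hasFDerivAt_id x).add (HasFDerivAt.fun_sum fun i _ =>
    (((hφ i).differentiableAt hΩ hx).hasFDerivAt.const_smul (a i)))

theorem jacobian_affineMapOp (hΩ : IsOpen Ω) (hφ : ∀ i, IsC1UpToBoundary Ω (φ i))
    (a : EuclideanSpace ℝ (Fin M)) {x : Plane} (hx : x ∈ Ω) :
    jacobian (affineMapOp φ a) x = detPoly a (gradEntries φ x) := by
  rw [jacobian, (hasFDerivAt_affineMapOp hΩ hφ a hx).fderiv, det_eq]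
  simp only [detPoly, gradEntries, add_apply, ContinuousLinearMap.id_apply, sum_apply, smul_apply,
    PiLp.add_apply, PiLp.smul_apply, smul_eq_mul, WithLp.ofLp_sum, Finset.sum_apply]
  simp

theorem exists_norm_gradEntries_le (hΩ : IsPolygonalDomain Ω)
    (hφ : ∀ i, IsC1UpToBoundary Ω (φ i)) :
    ∃ C : ℝ, 0 ≤ C ∧ ∀ x ∈ Ω, ‖gradEntries φ x‖ ≤ C := by
  choose K hK using fun i => (hφ i).exists_norm_fderiv_le hΩ
  refine ⟨∑ i, (K i : ℝ), by positivity, fun x hx => ?_⟩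
  have h0 : (0 : ℝ) ≤ ∑ i, (K i : ℝ) := by positivity
  refine (pi_norm_le_iff_of_nonneg h0).2 fun i => (pi_norm_le_iff_of_nonneg h0).2 fun k =>
    (pi_norm_le_iff_of_nonneg h0).2 fun l => ?_
  calc ‖fderiv ℝ (φ i) x (EuclideanSpace.single l 1) k‖
      ≤ ‖fderiv ℝ (φ i) x (EuclideanSpace.single l 1)‖ := PiLp.norm_apply_le _ _
    _ ≤ ‖fderiv ℝ (φ i) x‖ * ‖(EuclideanSpace.single l (1 : ℝ) : Plane)‖ :=
        ContinuousLinearMap.le_opNorm _ _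
    _ = ‖fderiv ℝ (φ i) x‖ := by simp
    _ ≤ K i := hK i x hx
    _ ≤ ∑ i, (K i : ℝ) := Finset.single_le_sum (fun j _ => (K j).2) (Finset.mem_univ i)

theorem continuousOn_gradEntries (hΩ : IsOpen Ω) (hφ : ∀ i, IsC1UpToBoundary Ω (φ i)) :
    ContinuousOn (gradEntries φ) Ω := by
  refine continuousOn_pi.2 fun i => continuousOn_pi.2 fun k => continuousOn_pi.2 fun l => ?_
  have h := ((hφ i).1.continuousOn_fderiv_of_isOpen hΩ le_rfl).clm_apply
    (continuousOn_const (c := (EuclideanSpace.single l (1 : ℝ) : Plane)))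
  exact (EuclideanSpace.proj k : Plane →L[ℝ] ℝ).continuous.comp_continuousOn h

theorem IsPolygonalDomain.volume_lt_top (hΩ : IsPolygonalDomain Ω) : volume Ω < ⊤ :=
  hΩ.isBounded.measure_lt_top

theorem IsPolygonalDomain.volume_real_pos (hΩ : IsPolygonalDomain Ω) : 0 < volume.real Ω :=
  ENNReal.toReal_pos (hΩ.isOpen.measure_pos volume hΩ.nonempty).ne' hΩ.volume_lt_top.ne

/-- The gradient entries range over a bounded set, so one Lipschitz constant on a compact product of
balls serves all `x`. It is used with `G` the identity and with `G` the exponential barrier. -/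
theorem exists_bound_comp_detPoly (hΩ : IsPolygonalDomain Ω)
    (hφ : ∀ i, IsC1UpToBoundary Ω (φ i)) {G : ℝ → ℝ} (hG : ContDiff ℝ 1 G) (R : ℝ) :
    ∃ L : ℝ≥0, ∀ x ∈ Ω, LipschitzOnWith L (fun a => G (detPoly a (gradEntries φ x)))
      (Metric.closedBall 0 R) := by
  obtain ⟨C, hC, hbd⟩ := exists_norm_gradEntries_le hΩ hφ
  obtain ⟨L, hL⟩ := (hG.comp (contDiff_detPoly M)).contDiffOn.exists_lipschitzOnWith one_ne_zero
    ((convex_closedBall (0 : EuclideanSpace ℝ (Fin M)) R).prod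
      (convex_closedBall (0 : Fin M → Fin 2 → Fin 2 → ℝ) C))
    ((isCompact_closedBall _ _).prod (isCompact_closedBall _ _))
  refine ⟨L, fun x hx => LipschitzOnWith.of_dist_le_mul fun a ha b hb => ?_⟩
  have hm : gradEntries φ x ∈ Metric.closedBall 0 C := by
    rw [mem_closedBall_zero_iff]; exact hbd x hx
  have h := hL.dist_le_mul (a, gradEntries φ x) ⟨ha, hm⟩ (b, gradEntries φ x) ⟨hb, hm⟩
  rw [Prod.dist_eq, dist_self, max_eq_left dist_nonneg] at h
  exact h

theorem integrableOn_comp_detPoly (hΩ : IsPolygonalDomain Ω)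
    (hφ : ∀ i, IsC1UpToBoundary Ω (φ i)) {G : ℝ → ℝ} (hG : ContDiff ℝ 1 G)
    (a : EuclideanSpace ℝ (Fin M)) :
    IntegrableOn (fun x => G (detPoly a (gradEntries φ x))) Ω := by
  obtain ⟨L, hL⟩ := exists_bound_comp_detPoly hΩ hφ hG ‖a‖
  have hcont : Continuous fun m : Fin M → Fin 2 → Fin 2 → ℝ => G (detPoly a m) :=
    (hG.comp (contDiff_detPoly M)).continuous.comp (Continuous.prodMk_right a)
  have : Fact (volume Ω < ⊤) := ⟨hΩ.volume_lt_top⟩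
  refine Integrable.of_bound
    ((hcont.comp_continuousOn (continuousOn_gradEntries hΩ.isOpen hφ)).aestronglyMeasurable
      hΩ.isOpen.measurableSet) (|G 1| + L * ‖a‖) ?_
  rw [ae_restrict_iff' hΩ.isOpen.measurableSet]
  refine Eventually.of_forall fun x hx => ?_
  have h := (hL x hx).dist_le_mul a (by simp) 0 (by simp)
  rw [detPoly_zero, dist_zero_right, Real.dist_eq] at h
  rw [Real.norm_eq_abs]
  linarith [abs_sub_abs_le_abs_sub (G (detPoly a (gradEntries φ x))) (G 1)]

theorem lipschitzOnWith_integral_comp_detPoly (hΩ : IsPolygonalDomain Ω)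
    (hφ : ∀ i, IsC1UpToBoundary Ω (φ i)) {G : ℝ → ℝ} (hG : ContDiff ℝ 1 G) (R : ℝ) :
    ∃ L : ℝ≥0, LipschitzOnWith L (fun a => ∫ x in Ω, G (detPoly a (gradEntries φ x)))
      (Metric.closedBall 0 R) := by
  obtain ⟨L, hL⟩ := exists_bound_comp_detPoly hΩ hφ hG R
  refine ⟨L * (volume Ω).toNNReal, LipschitzOnWith.of_dist_le_mul fun a ha b hb => ?_⟩
  rw [dist_eq_norm, ← integral_sub (integrableOn_comp_detPoly hΩ hφ hG a)
    (integrableOn_comp_detPoly hΩ hφ hG b)]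
  refine (norm_setIntegral_le_of_norm_le_const (C := L * dist a b) hΩ.volume_lt_top
    fun x hx => ?_).trans (le_of_eq ?_)
  · rw [← dist_eq_norm]
    exact (hL x hx).dist_le_mul a ha b hb
  · rw [NNReal.coe_mul, ENNReal.coe_toNNReal_eq_toReal, Measure.real]
    ring

/-! ### Bounds for linear combinations of the fields -/

theorem exists_bounds_sum_smul (hΩ : IsPolygonalDomain Ω) (hφ : ∀ i, IsC1UpToBoundary Ω (φ i)) :
    ∃ κ : ℝ≥0, ∀ a : EuclideanSpace ℝ (Fin M),
      LipschitzOnWith (‖a‖₊ * κ) (∑ i, a i • φ i) (closure Ω) ∧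
      ∀ x ∈ closure Ω, ‖(∑ i, a i • φ i) x‖ ≤ ‖a‖ * κ := by
  choose K hK using fun i => (hφ i).exists_lipschitzOnWith hΩ
  choose B hB using fun i => hΩ.isCompact_closure.exists_bound_of_continuousOn (hφ i).2.1
  refine ⟨∑ i, K i + ∑ i, (B i).toNNReal, fun a => ⟨LipschitzOnWith.of_dist_le_mul
    fun x hx y hy => ?_, fun x hx => ?_⟩⟩
  · have e : (∑ i, a i • φ i) x - (∑ i, a i • φ i) y = ∑ i, a i • (φ i x - φ i y) := by
      simp [Finset.sum_apply, smul_sub]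
    rw [dist_eq_norm, e]
    calc ‖∑ i, a i • (φ i x - φ i y)‖ ≤ ∑ i, ‖a‖ * (K i * dist x y) := by
          refine norm_sum_le_of_le _ fun i _ => ?_
          rw [norm_smul]
          have h1 := (hK i).dist_le_mul x hx y hy
          rw [dist_eq_norm] at h1
          exact mul_le_mul (PiLp.norm_apply_le a i) h1 (norm_nonneg _) (norm_nonneg _)
      _ = ‖a‖ * (∑ i, (K i : ℝ)) * dist x y := by
          rw [← Finset.mul_sum, ← Finset.sum_mul, mul_assoc]
      _ ≤ _ := by
          push_cast
          gcongr
          exact le_add_of_nonneg_right (by positivity)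
  · rw [Finset.sum_apply]
    calc ‖∑ i, (a i • φ i) x‖ ≤ ∑ i, ‖a‖ * ((B i).toNNReal : ℝ) := by
          refine norm_sum_le_of_le _ fun i _ => ?_
          rw [Pi.smul_apply, norm_smul]
          exact mul_le_mul (PiLp.norm_apply_le a i)
            ((hB i x hx).trans (Real.le_coe_toNNReal _)) (norm_nonneg _) (norm_nonneg _)
      _ = ‖a‖ * ∑ i, ((B i).toNNReal : ℝ) := by rw [← Finset.mul_sum]
      _ ≤ _ := by
          rw [NNReal.coe_add, NNReal.coe_sum, NNReal.coe_sum]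
          gcongr
          exact le_add_of_nonneg_left (by positivity)

theorem bijOn_affineMapOp (hΩ : IsPolygonalDomain Ω) (hU0 : ∀ i, MemU0 Ω (φ i)) :
    ∃ δ > 0, ∀ a : EuclideanSpace ℝ (Fin M), ‖a‖ < δ → BijOn (affineMapOp φ a) Ω Ω := by
  obtain ⟨κ, hκ⟩ := exists_bounds_sum_smul hΩ fun i => (hU0 i).1
  -- This radius makes the Lipschitz constant `‖a‖ * κ` of the displacement smaller than one.
  refine ⟨((κ : ℝ) + 1)⁻¹, by positivity, fun a ha => ?_⟩
  rw [affineMapOp_eq]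
  refine (MemU0.sum hΩ.isOpen hU0 a).bijOn hΩ ?_ (hκ a).1
  rw [← NNReal.coe_lt_coe, NNReal.coe_mul, coe_nnnorm, NNReal.coe_one]
  have h : ‖a‖ * ((κ : ℝ) + 1) < 1 := by rwa [← lt_div_iff₀ (by positivity), one_div]
  nlinarith [norm_nonneg a]

/-- The average of the Jacobian determinant of the maps `id + ∑ aᵢ φᵢ` is one. -/
theorem integral_detPoly (hΩ : IsPolygonalDomain Ω) (hU0 : ∀ i, MemU0 Ω (φ i))
    (a : EuclideanSpace ℝ (Fin M)) :
    ∫ x in Ω, detPoly a (gradEntries φ x) = volume.real Ω := by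
  have hφ := fun i => (hU0 i).1
  obtain ⟨δ, hδ, hbij⟩ := bijOn_affineMapOp hΩ hU0
  obtain ⟨L, hL⟩ := exists_bound_comp_detPoly hΩ hφ contDiff_id 1
  -- The three bounds give bijectivity, membership in the unit ball where `L` is valid, and a
  -- nonnegative Jacobian, since it differs from one by at most `L * ‖b‖`.
  set ρ : ℝ := min δ (min 1 ((L : ℝ) + 1)⁻¹) with hρ
  have hρ0 : 0 < ρ := by positivity
  have hsmall : ∀ b : EuclideanSpace ℝ (Fin M), ‖b‖ < ρ →
      ∫ x in Ω, detPoly b (gradEntries φ x) = volume.real Ω := by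
    intro b hb
    have hb1 : ‖b‖ < δ := hb.trans_le (min_le_left _ _)
    have hb2 : ‖b‖ < 1 := hb.trans_le ((min_le_right _ _).trans (min_le_left _ _))
    have hb3 : ‖b‖ < ((L : ℝ) + 1)⁻¹ := hb.trans_le ((min_le_right _ _).trans (min_le_right _ _))
    have hpos : ∀ x ∈ Ω, 0 ≤ detPoly b (gradEntries φ x) := by
      intro x hx
      have h := (hL x hx).dist_le_mul b (by simpa using hb2.le) 0 (by simp)
      rw [detPoly_zero, dist_zero_right, Real.dist_eq, id, id] at h
      have h2 : ‖b‖ * ((L : ℝ) + 1) < 1 := by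
        rwa [← lt_div_iff₀ (by positivity), one_div]
      have := (abs_le.1 h).1
      nlinarith [norm_nonneg b]
    have hcv := integral_image_eq_integral_abs_det_fderiv_smul volume hΩ.isOpen.measurableSet
      (fun x hx => (hasFDerivAt_affineMapOp hΩ.isOpen hφ b hx).hasFDerivWithinAt)
      (hbij b hb1).injOn (fun _ => (1 : ℝ))
    rw [(hbij b hb1).image_eq] at hcv
    simp only [smul_eq_mul, mul_one, integral_const, MeasurableSet.univ, measureReal_restrict_apply,
      univ_inter] at hcv
    rw [hcv]
    refine setIntegral_congr_fun hΩ.isOpen.measurableSet fun x hx => ?_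
    have h1 := jacobian_affineMapOp hΩ.isOpen hφ b hx
    rw [jacobian, (hasFDerivAt_affineMapOp hΩ.isOpen hφ b hx).fderiv] at h1
    simp only [h1]
    rw [abs_of_nonneg (hpos x hx)]
  -- Both `s • a` and `(2 * s) • a` are small enough for the change of variables.
  obtain ⟨s, hs0, hs⟩ : ∃ s : ℝ, 0 < s ∧ 2 * s * ‖a‖ < ρ := by
    refine ⟨ρ / (2 * (‖a‖ + 1)), by positivity, ?_⟩
    have : 2 * (ρ / (2 * (‖a‖ + 1))) * ‖a‖ = ρ * (‖a‖ / (‖a‖ + 1)) := by field_simp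
    rw [this]
    refine mul_lt_of_lt_one_right hρ0 ?_
    rw [div_lt_one (by positivity)]
    linarith
  have hs1 := hsmall (s • a) (by
    rw [norm_smul, Real.norm_of_nonneg hs0.le]; nlinarith [norm_nonneg a])
  have hs2 := hsmall ((2 * s) • a) (by
    rw [norm_smul, Real.norm_of_nonneg (by positivity)]; exact hs)
  have hint : ∀ b : EuclideanSpace ℝ (Fin M),
      IntegrableOn (fun x => detPoly b (gradEntries φ x)) Ω := fun b =>
    integrableOn_comp_detPoly hΩ hφ contDiff_id b
  -- Lagrange weights for evaluating a quadratic polynomial at `1` from the nodes `s` and `2 * s`;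
  -- the node `0`, with value one, has weight `1 - α - β`.
  set α : ℝ := 2 / s - 1 / s ^ 2 with hα
  set β : ℝ := 1 / (2 * s ^ 2) - 1 / (2 * s) with hβ
  have hpoly : ∀ x, detPoly a (gradEntries φ x) =
      α * detPoly (s • a) (gradEntries φ x) + β * detPoly ((2 * s) • a) (gradEntries φ x) +
        (1 - α - β) := by
    intro x
    have h1 := detPoly_smul a (gradEntries φ x) 1
    rw [one_smul] at h1
    rw [detPoly_smul, detPoly_smul, h1, hα, hβ]
    field_simp
    ring
  simp_rw [hpoly]
  have hsum : IntegrableOn (fun x => α * detPoly (s • a) (gradEntries φ x) +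
      β * detPoly ((2 * s) • a) (gradEntries φ x)) Ω :=
    ((hint _).const_mul _).add ((hint _).const_mul _)
  rw [integral_add hsum (integrableOn_const hΩ.volume_lt_top.ne),
    integral_add ((hint _).const_mul _) ((hint _).const_mul _), integral_const_mul,
    integral_const_mul, hs1, hs2, setIntegral_const, smul_eq_mul]
  ring

/-! ### The exponential barrier -/

theorem fJac_affineMapOp (hΩ : IsOpen Ω) (hφ : ∀ i, IsC1UpToBoundary Ω (φ i)) (ε Cexp : ℝ)
    (a : EuclideanSpace ℝ (Fin M)) :
    fJac Ω ε Cexp (affineMapOp φ a) =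
      (volume.real Ω)⁻¹ * ∫ x in Ω, Real.exp ((ε - detPoly a (gradEntries φ x)) / Cexp) := by
  rw [fJac]
  congr 1
  refine setIntegral_congr_fun hΩ.measurableSet fun x hx => ?_
  simp only [jacobian_affineMapOp hΩ hφ a hx]

theorem fJac_affineMapOp_zero (hΩ : IsPolygonalDomain Ω) (hφ : ∀ i, IsC1UpToBoundary Ω (φ i))
    (ε Cexp : ℝ) : fJac Ω ε Cexp (affineMapOp φ 0) = Real.exp ((ε - 1) / Cexp) := by
  rw [fJac_affineMapOp hΩ.isOpen hφ]
  simp only [detPoly_zero]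
  rw [setIntegral_const, smul_eq_mul, inv_mul_cancel_left₀ hΩ.volume_real_pos.ne']

theorem contDiff_exp_barrier (ε Cexp : ℝ) :
    ContDiff ℝ 1 (fun t : ℝ => Real.exp ((ε - t) / Cexp)) := by fun_prop

/-- Jensen's inequality, obtained by integrating the tangent line of the exponential at Jacobian
one. The linear term integrates to zero because the average Jacobian is one. -/
theorem le_fJac_affineMapOp (hΩ : IsPolygonalDomain Ω) (hU0 : ∀ i, MemU0 Ω (φ i))
    (ε Cexp : ℝ) (a : EuclideanSpace ℝ (Fin M)) :
    Real.exp ((ε - 1) / Cexp) ≤ fJac Ω ε Cexp (affineMapOp φ a) := by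
  have hφ := fun i => (hU0 i).1
  rw [fJac_affineMapOp hΩ.isOpen hφ, inv_mul_eq_div, le_div_iff₀ hΩ.volume_real_pos]
  set E := Real.exp ((ε - 1) / Cexp) with hE
  have hint : IntegrableOn (fun x => detPoly a (gradEntries φ x)) Ω :=
    integrableOn_comp_detPoly hΩ hφ contDiff_id a
  have hc : ∀ c : ℝ, IntegrableOn (fun _ : Plane => c) Ω := fun c =>
    integrableOn_const hΩ.volume_lt_top.ne
  have h1 : ∫ x in Ω, (E * (1 + 1 / Cexp) - E / Cexp * detPoly a (gradEntries φ x)) =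
      E * volume.real Ω := by
    rw [integral_sub (hc _) (hint.const_mul _), integral_const_mul (E / Cexp), integral_detPoly hΩ hU0,
      setIntegral_const, smul_eq_mul]
    ring
  rw [← h1]
  refine setIntegral_mono ((hc _).sub (hint.const_mul _))
    (integrableOn_comp_detPoly hΩ hφ (contDiff_exp_barrier ε Cexp) a) fun x => ?_
  set d := detPoly a (gradEntries φ x)
  have h2 := Real.add_one_le_exp ((1 - d) / Cexp)
  have h3 : Real.exp ((ε - d) / Cexp) = E * Real.exp ((1 - d) / Cexp) := by
    rw [hE, ← Real.exp_add]; congr 1; ring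
  have h4 := mul_le_mul_of_nonneg_left h2 (Real.exp_pos ((ε - 1) / Cexp)).le
  rw [← hE, ← h3] at h4
  refine le_trans (le_of_eq ?_) h4
  ring

end

end Registration

end

/-! ### The requirements on the mapping space -/

open Registration in
theorem mainTheorem7 (Ω : Set Registration.Plane) (hΩ : Registration.IsRegularPolytope Ω)
    (ε Cexp : ℝ) (hε : 0 < ε) (hCexp : 0 < Cexp)
    (M : ℕ) (φ : Fin M → Registration.Plane → Registration.Plane)
    (hU0 : ∀ i, Registration.MemU0 Ω (φ i)) (hW : ∀ i, Registration.MemW2Infty Ω (φ i))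
    (hlin : LinearIndependent ℝ (fun i => (closure Ω).domRestrict (φ i))) :
    Registration.SatisfiesRequirements Ω (Registration.affineMapOp φ)
      (fun a => Registration.fPenTh Ω ε Cexp (Registration.affineMapOp φ a)) := by
  have hP := hΩ.isPolygonalDomain
  have hφ := fun i => (hU0 i).1
  obtain ⟨κ, hκ⟩ := exists_bounds_sum_smul hP hφ
  obtain ⟨p, hp, ⟨c, hc, hcp⟩, hp0, Cp, hCp⟩ := exists_hessian_bounds hP hU0 hW hlin
  have hf : ∀ a, fPenTh Ω ε Cexp (affineMapOp φ a) =
      fJac Ω ε Cexp (affineMapOp φ a) + p a ^ 2 := fun a => by rw [fPenTh, hp]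
  have hlip : ∀ a, ∃ K : ℝ, LipNormLE Ω (affineMapOp φ a) K := by
    intro a
    obtain ⟨B, hB⟩ := hP.isBounded.exists_norm_le
    refine ⟨|B| + 1 + ‖a‖ * κ, fun x hx => ?_, fun x hx y hy => ?_⟩
    · rw [affineMapOp_eq]
      refine (norm_add_le _ _).trans ?_
      linarith [hB x hx, (hκ a).2 x (subset_closure hx), le_abs_self B]
    · have h1 := (hκ a).1.dist_le_mul x (subset_closure hx) y (subset_closure hy)
      rw [dist_eq_norm, dist_eq_norm, NNReal.coe_mul, coe_nnnorm] at h1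
      rw [affineMapOp_eq]
      simp only [add_sub_add_comm]
      refine (norm_add_le _ _).trans ?_
      nlinarith [mul_nonneg (abs_nonneg B) (norm_nonneg (x - y))]
  refine ⟨hlip, fun a => ?_, ?_, ?_, ?_, ?_⟩
  · rw [hf]
    have := (Real.exp_pos _).le.trans (le_fJac_affineMapOp hP hU0 ε Cexp a)
    positivity
  · obtain ⟨δ, hδ, hbij⟩ := bijOn_affineMapOp hP hU0
    have h0 : fPenTh Ω ε Cexp (affineMapOp φ 0) = Real.exp ((ε - 1) / Cexp) := by
      rw [hf, hp0, fJac_affineMapOp_zero hP hφ]; ring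
    -- Since the barrier is at least its value at `0`, this level leaves `(c * (δ / 2)) ^ 2` for the
    -- Hessian term, which forces `‖a‖ ≤ δ / 2 < δ`.
    refine ⟨Real.exp ((ε - 1) / Cexp) + (c * (δ / 2)) ^ 2, by positivity, fun a ha => ?_, ?_⟩
    · rw [hf] at ha
      have h1 := le_fJac_affineMapOp hP hU0 ε Cexp a
      have h2 : p a ^ 2 ≤ (c * (δ / 2)) ^ 2 := by linarith
      have h3 : p a ≤ c * (δ / 2) := (le_abs_self _).trans (abs_le_of_sq_le_sq h2 (by positivity))
      have h4 : ‖a‖ ≤ δ / 2 := le_of_mul_le_mul_left ((hcp a).trans h3) hc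
      refine ⟨?_, hbij a (by linarith)⟩
      obtain ⟨K, hK⟩ := hlip a
      refine ⟨K.toNNReal, LipschitzOnWith.of_dist_le_mul fun x hx y hy => ?_⟩
      rw [dist_eq_norm, dist_eq_norm]
      exact (hK.2 x hx y hy).trans
        (mul_le_mul_of_nonneg_right (Real.le_coe_toNNReal K) (norm_nonneg _))
    · simp only [h0]
      exact lt_add_of_pos_right _ (by positivity)
  · ext1 x
    simp [affineMapOp]
  · refine ⟨κ, fun a b => ?_⟩
    have e : ∀ x, affineMapOp φ a x - affineMapOp φ b x = (∑ i, (a - b) i • φ i) x := fun x => by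
      simp [affineMapOp, Finset.sum_apply, sub_smul]
    refine ⟨fun x hx => ?_, fun x hx y hy => ?_⟩
    · simp only [e]
      rw [mul_comm]
      exact (hκ (a - b)).2 x (subset_closure hx)
    · have h1 := (hκ (a - b)).1.dist_le_mul x (subset_closure hx) y (subset_closure hy)
      rw [dist_eq_norm, dist_eq_norm, NNReal.coe_mul, coe_nnnorm, mul_comm ‖a - b‖] at h1
      simpa only [e] using h1
  · intro R
    obtain ⟨L, hL⟩ := lipschitzOnWith_integral_comp_detPoly hP hφ (contDiff_exp_barrier ε Cexp) R
    -- The second summand comes from factoring the difference of squares of `p`. The absolute value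
    -- of `R` keeps the constant nonnegative when `R` is negative and the ball is empty.
    refine ⟨((volume.real Ω)⁻¹ * L + Cp * (2 * (Cp * |R|))).toNNReal,
      LipschitzOnWith.of_dist_le_mul fun a ha b hb => ?_⟩
    rw [Real.coe_toNNReal _ (by positivity)]
    have h1 := hL.dist_le_mul a ha b hb
    have h2 := hCp.dist_le_mul a b
    have hpb : ∀ a ∈ Metric.closedBall (0 : EuclideanSpace ℝ (Fin M)) R, |p a| ≤ Cp * |R| := by
      intro a ha
      have h3 := hCp.dist_le_mul a 0
      rw [hp0, Real.dist_eq, sub_zero] at h3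
      exact h3.trans (mul_le_mul_of_nonneg_left
        ((Metric.mem_closedBall.1 ha).trans (le_abs_self R)) Cp.2)
    have h3 : |p a ^ 2 - p b ^ 2| ≤ Cp * (2 * (Cp * |R|)) * dist a b := by
      rw [sq_sub_sq, abs_mul]
      have h4 : |p a + p b| ≤ 2 * (Cp * |R|) :=
        (abs_add_le _ _).trans (by linarith [hpb a ha, hpb b hb])
      calc |p a + p b| * |p a - p b| ≤ (2 * (Cp * |R|)) * (Cp * dist a b) :=
            mul_le_mul h4 h2 (abs_nonneg _) (by positivity)
        _ = _ := by ring
    have h5 : |fJac Ω ε Cexp (affineMapOp φ a) - fJac Ω ε Cexp (affineMapOp φ b)| ≤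
        (volume.real Ω)⁻¹ * L * dist a b := by
      rw [fJac_affineMapOp hP.isOpen hφ, fJac_affineMapOp hP.isOpen hφ, ← mul_sub, abs_mul,
        abs_of_pos (inv_pos.2 hP.volume_real_pos), mul_assoc]
      exact mul_le_mul_of_nonneg_left h1 (inv_pos.2 hP.volume_real_pos).le
    rw [Real.dist_eq, hf, hf, add_sub_add_comm]
    refine (abs_add_le _ _).trans ?_
    rw [add_mul]
    exact add_le_add h5 h3
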